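/- Let $\Bbbk$ be an algebraically closed field of characteristic $0$, let $a,b,k,\ell,p,q,t\in\Bbbk$ with $t\neq 0$, and let $V$ be the vector space with basis $x_1,x_2,x_3$ and with the braiding $c\colon V\otimes V\to V\otimes V$ associated with the solution $\mathfrak R_{1,5}$ of the quantum Yang–Baxter equation: \begin{align*} c(x_1\otimes x_1)&=t\,x_1\otimes x_1, & c(x_2\otimes x_1)&=t\,x_1\otimes x_2+t\ell\,x_1\otimes x_1,\\ c(x_3\otimes x_1)&=t\,x_1\otimes x_3, & c(x_1\otimes x_2)&=t\,x_2\otimes x_1-t\ell\,x_1\otimes x_1,\\ c(x_1\otimes x_3)&=t\,x_3\otimes x_1+tp\,x_1\otimes x_1, \end{align*} \begin{align*} c(x_2\otimes x_2)&=t\,x_2\otimes x_2+t\ell\,x_2\otimes x_1-t\ell\,x_1\otimes x_2-t\ell^2\,x_1\otimes x_1,\\ c(x_3\otimes x_2)&=t\,x_2\otimes x_3-t\ell\,x_1\otimes x_3+t(\ell q-k)\,x_1\otimes x_1,\\ c(x_2\otimes x_3)&=t\,x_3\otimes x_2+t\ell\,x_3\otimes x_1+t(p-q)\,x_2\otimes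 x_1+tq\,x_1\otimes x_2+tk\,x_1\otimes x_1,\\ c(x_3\otimes x_3)&=t\,x_3\otimes x_3+tp\,x_1\otimes x_3-tb\,x_2\otimes x_1+tb\,x_1\otimes x_2+ta\,x_1\otimes x_1. \end{align*} Let $\mathcal J(V)=\bigoplus_{n\ge 2}\ker Q_n\subseteq T(V)$, where $Q_n=\sum_{\sigma\in\mathbb S_n}\rho_n(M(\sigma))\in\operatorname{End}(T^n(V))$ is the $n$-th quantum symmetrizer of $c$ ($\rho_n$ is the representation of the braid group $\mathbb B_n$ on $T^n(V)$ induced by $c$, and $M\colon\mathbb S_n\to\mathbb B_n$ is the Matsumoto section), and let $\mathfrak B(V)=T(V)/\mathcal J(V)$ be the Nichols algebra of $(V,c)$. A set of ordered monomials $x_1^{a_1}x_2^{a_2}x_3^{a_3}$ that is a linear basis of $\mathfrak B(V)$ is called a PBW-basis. Assume that $t=-1$ and $p=0$. (1) If $a\neq b\ell$, then $\mathcal J(V)$ is the two-sided ideal $$\langle x_2x_1+x_1x_2,\ x_3x_1+x_1x_3,\ x_3x_2+x_2x_3-\ell\,x_1x_3+q\,x_1x_2,\ x_1^2,\ x_2^2-\ell\,x_1x_2\rangle,$$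 the set $B_1=\{x_1^{a_1}x_2^{a_2}x_3^{a_3}: a_1,a_2\in\{0,1\},\ a_3\ge 0\}$ is a PBW-basis of $\mathfrak B(V)$, and $\operatorname{GKdim}\mathfrak B(V)=1$. (2) If $a=b\ell$, then $\mathcal J(V)$ is the two-sided ideal $$\langle x_2x_1+x_1x_2,\ x_3x_1+x_1x_3,\ x_3x_2+x_2x_3-\ell\,x_1x_3+q\,x_1x_2,\ x_1^2,\ x_2^2-\ell\,x_1x_2,\ x_3^2+b\,x_1x_2\rangle,$$ the set $B_0=\{x_1^{a_1}x_2^{a_2}x_3^{a_3}: a_1,a_2,a_3\in\{0,1\}\}$ is a PBW-basis of $\mathfrak B(V)$, and $\dim\mathfrak B(V)=8$. -/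

import Mathlib

namespace NicholsRankThree

noncomputable section

/-! ### The Nichols algebra of a braiding given in a basis

`V` is the vector space with basis `x_i`, `i : ι`. A linear endomorphism `c` of `V ⊗ V` is given by
its matrix `r`, whose entry in row `(k, l)` and column `(i, j)` is the coefficient `r^{ij}_{kl}` of
`x_k ⊗ x_l` in `c (x_i ⊗ x_j)`. The tensor algebra `T(V)` is the free algebra on the `x_i`. -/

section Nichols

variable {K : Type*} [Field K] {ι : Type*} [Fintype ι] [DecidableEq ι]

/-- The tensor power `T^n(V)`, in coordinates with respect to the words
`x_{w 0} ⊗ ⋯ ⊗ x_{w (n - 1)}` of length `n`. -/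
abbrev TPow (K : Type*) (ι : Type*) (n : ℕ) : Type _ := (Fin n → ι) → K

/-- The inclusion `T^n(V) → T(V)`. -/
def toFree (K : Type*) [Field K] (ι : Type*) [Fintype ι] [DecidableEq ι] (n : ℕ) :
    TPow K ι n →ₗ[K] FreeAlgebra K ι :=
  Fintype.linearCombination K
    (fun w : Fin n → ι => (List.ofFn fun i => FreeAlgebra.ι K (w i)).prod)

/-- The operator on `T^n(V)` that applies `c` to the tensor factors at the positions `i` and `i + 1`
(positions are counted from `0`), that is `ρ_n` of the corresponding generator of the braid group.
It is only used for `i + 1 < n`. -/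
def braidAt (r : Matrix (ι × ι) (ι × ι) K) (n i : ℕ) : Module.End K (TPow K ι n) :=
  if h : i + 1 < n then
    { toFun := fun f w => ∑ u : ι × ι,
        r (w ⟨i, by omega⟩, w ⟨i + 1, h⟩) u *
          f (Function.update (Function.update w ⟨i, by omega⟩ u.1) ⟨i + 1, h⟩ u.2)
      map_add' := fun f g => by
        funext w
        simp [mul_add, Finset.sum_add_distrib]
      map_smul' := fun m f => by
        funext w
        simp [Finset.mul_sum, mul_left_comm] }
  else 1

/-- A reduced word for a permutation `σ`, in the adjacent transpositions `s_i = (i, i + 1)`.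
Let `m = σ⁻¹ 0`. The product `s_0 s_1 ⋯ s_{m-1}` sends `m` to `0`, is increasing on the remaining
points, and `σ = σ' s_0 s_1 ⋯ s_{m-1}` where `σ'` fixes `0`; the number of inversions of `σ` is that
of `σ'` plus `m`. The permutation `σ'` is, on the remaining points, a permutation of one point less
(with the points shifted by one), to which the construction is applied again. -/
def reducedWord : (n : ℕ) → Equiv.Perm (Fin n) → List ℕ
  | 0, _ => []
  | n + 1, σ =>
      (reducedWord n (Equiv.removeNone
        ((finSuccEquiv' (σ.symm 0)).symm.trans (σ.trans (finSuccEquiv n))))).map (fun i => i + 1)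
        ++ List.range (σ.symm 0 : ℕ)

/-- `ρ_n (M (σ))`, where `M` is the Matsumoto section: the value of a reduced word of `σ`. -/
def matsumoto (r : Matrix (ι × ι) (ι × ι) K) (n : ℕ) (σ : Equiv.Perm (Fin n)) :
    Module.End K (TPow K ι n) :=
  ((reducedWord n σ).map (braidAt r n)).prod

/-- The quantum symmetrizer `Q_n = ∑_{σ ∈ S_n} ρ_n (M (σ))`. -/
def quantumSymmetrizer (r : Matrix (ι × ι) (ι × ι) K) (n : ℕ) : Module.End K (TPow K ι n) :=
  ∑ σ : Equiv.Perm (Fin n), matsumoto r n σ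

/-- `J(V) = ⨁_{n ≥ 2} ker Q_n`, as a subspace of `T(V)`. -/
def defRel (r : Matrix (ι × ι) (ι × ι) K) : Submodule K (FreeAlgebra K ι) :=
  ⨆ (n : ℕ) (_ : 2 ≤ n), (LinearMap.ker (quantumSymmetrizer r n)).map (toFree K ι n)

/-- The Nichols algebra `B(V) = T(V) / J(V)`. (For a braiding, `J(V)` is already a two-sided ideal;
taking the two-sided ideal that it generates makes the quotient an algebra by construction.) -/
abbrev NicholsAlgebra (r : Matrix (ι × ι) (ι × ι) K) : Type _ :=
  FreeAlgebra K ι ⧸ (TwoSidedIdeal.span (defRel r : Set (FreeAlgebra K ι))).asIdeal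

/-- The class of `x_i` in `B(V)`. -/
def NicholsAlgebra.gen (r : Matrix (ι × ι) (ι × ι) K) (i : ι) : NicholsAlgebra r :=
  Ideal.Quotient.mk _ (FreeAlgebra.ι K i)

end Nichols

/-- The ordered monomials `x_1^{a_1} x_2^{a_2} x_3^{a_3}` with `a_i < h_i` (where `h_i = ⊤` means
that `a_i` is not restricted) form a linear basis of `A`. -/
def IsPBWBasis (K : Type*) [Field K] {A : Type*} [Ring A] [Algebra K A]
    (x : Fin 3 → A) (h : Fin 3 → ℕ∞) : Prop :=
  let mon : {e : Fin 3 → ℕ // ∀ i, (e i : ℕ∞) < h i} → A :=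
    fun e => x 0 ^ e.1 0 * x 1 ^ e.1 1 * x 2 ^ e.1 2
  LinearIndependent K mon ∧ Submodule.span K (Set.range mon) = ⊤

/-- The Gelfand-Kirillov dimension
`sup_W limsup_n log (dim (K + W + W^2 + ⋯ + W^n)) / log n`,
where `W` runs over the finite-dimensional subspaces of `A`. -/
def gkDim (K : Type*) [Field K] (A : Type*) [Ring A] [Algebra K A] : EReal :=
  ⨆ (W : Submodule K A) (_ : W.FG),
    Filter.limsup (fun n : ℕ =>
      ((Real.log (Module.finrank K (⨆ i ∈ Finset.range (n + 1), W ^ i : Submodule K A)) /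
        Real.log n : ℝ) : EReal)) Filter.atTop

/-! ### The braiding of type `R_{1,5}` -/

section R15

variable {K : Type*} [Field K]

/-- The `9 × 9` matrix `R_{1,5}`. Its rows are indexed by the pairs `(k, l)` in the order
`11, 12, 13, 21, 22, 23, 31, 32, 33`, its columns by the pairs `(i, j)` in the order
`11, 21, 31, 12, 22, 32, 13, 23, 33`. -/
def R15 (t p a b k ℓ q : K) : Matrix (Fin 9) (Fin 9) K :=
  !![t, t * ℓ, 0,  -(t * ℓ), -(t * ℓ ^ 2), t * (ℓ * q - k),  t * p, t * k, t * a;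
     0, t, 0,  0, -(t * ℓ), 0,  0, t * q, t * b;
     0, 0, t,  0, 0, -(t * ℓ),  0, 0, t * p;
     0, 0, 0,  t, t * ℓ, 0,  0, t * (p - q), -(t * b);
     0, 0, 0,  0, t, 0,  0, 0, 0;
     0, 0, 0,  0, 0, t,  0, 0, 0;
     0, 0, 0,  0, 0, 0,  t, t * ℓ, 0;
     0, 0, 0,  0, 0, 0,  0, t, 0;
     0, 0, 0,  0, 0, 0,  0, 0, t]

/-- The matrix of the braiding `c (x_i ⊗ x_j) = ∑_{k, l} r^{ij}_{kl} x_k ⊗ x_l` associated with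
`R_{1,5}`. The basis vectors are indexed by `Fin 3`, so that `0, 1, 2` stand for `1, 2, 3`;
`finProdFinEquiv (u, v) = v + 3 * u`. -/
def braiding15 (t p a b k ℓ q : K) : Matrix (Fin 3 × Fin 3) (Fin 3 × Fin 3) K :=
  fun row col => R15 t p a b k ℓ q (finProdFinEquiv (row.1, row.2)) (finProdFinEquiv (col.2, col.1))

/-- The basis vector `x_1` in `T(V)`. -/
abbrev x₁ (K : Type*) [Field K] : FreeAlgebra K (Fin 3) := FreeAlgebra.ι K 0
/-- The basis vector `x_2` in `T(V)`. -/
abbrev x₂ (K : Type*) [Field K] : FreeAlgebra K (Fin 3) := FreeAlgebra.ι K 1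
/-- The basis vector `x_3` in `T(V)`. -/
abbrev x₃ (K : Type*) [Field K] : FreeAlgebra K (Fin 3) := FreeAlgebra.ι K 2

end R15

end

end NicholsRankThree

open NicholsRankThree

/-!
The quantum symmetrizer factors as `Q_{n+1} = (id ⊗ Q_n) (1 + c_1 + c_1 c_2 + ⋯)`, so an element of
`T(V)` lies in `J(V)` exactly when all iterated skew derivations `∂_{k_n} ⋯ ∂_{k_1}`, followed by
the counit, vanish on it. The skew derivations exist on a quotient `A` of `T(V)` as soon as the
operators on `A × A³` by which the generators act on the pairs `(y, (∂_i y)_i)` satisfy the defining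
relations of `A`, and `J(V)` is then the kernel of `T(V) → A` if no nonzero element of `A` is killed
by all iterated derivations. The ordered monomials span `A`, so it is enough to show that they are
independent modulo the elements that are killed. The element `z = x_3^2 + b x_1 x_2` satisfies
`∂_1 z = (b ℓ - a) x_1`, `∂_2 z = ∂_3 z = 0`: for `a = b ℓ` it can be set to zero, and for
`a ≠ b ℓ` in characteristic `0` the sequence `1, x_1, z, x_1 z, z^2, …` is, up to nonzero scalars, a
Jordan chain of `∂_1`, which the factors `x_2` and `x_3` double twice.
-/

namespace NicholsRankThree

noncomputable section

section Symmetrizer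

variable {K : Type*} [Field K] {ι : Type*} [Fintype ι]

/-- The component of a tensor along `x_k ⊗ T^n(V)`, that is the contraction of its first factor with
the `k`-th vector of the dual basis. -/
def headComponent (K : Type*) [Field K] {ι : Type*} (n : ℕ) (k : ι) :
    TPow K ι (n + 1) →ₗ[K] TPow K ι n where
  toFun f w := f (Fin.cons k w)
  map_add' _ _ := rfl
  map_smul' _ _ := rfl

lemma headComponent_apply {K : Type*} [Field K] {ι : Type*} (n : ℕ) (k : ι)
    (f : TPow K ι (n + 1)) (w : Fin n → ι) :
    headComponent K n k f w = f (Fin.cons k w) := rfl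

lemma headComponent_braidAt_succ (r : Matrix (ι × ι) (ι × ι) K) (n i : ℕ) (k : ι)
    (f : TPow K ι (n + 1)) :
    headComponent K n k (braidAt r (n + 1) (i + 1) f) = braidAt r n i (headComponent K n k f) := by
  funext w
  by_cases h : i + 1 < n
  · have h' : i + 1 + 1 < n + 1 := by omega
    have hi : (⟨i + 1, by omega⟩ : Fin (n + 1)) = Fin.succ ⟨i, by omega⟩ := rfl
    have hi' : (⟨i + 1 + 1, h'⟩ : Fin (n + 1)) = Fin.succ ⟨i + 1, h⟩ := rfl
    simp only [headComponent_apply, braidAt, dif_pos h, dif_pos h', LinearMap.coe_mk,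
      AddHom.coe_mk, hi, hi', Fin.cons_succ, ← Fin.cons_update]
  · have h' : ¬ i + 1 + 1 < n + 1 := by omega
    rw [braidAt, dif_neg h', braidAt, dif_neg h, Module.End.one_apply, Module.End.one_apply]

lemma headComponent_braidAt_zero (r : Matrix (ι × ι) (ι × ι) K) (n : ℕ) (k l : ι)
    (f : TPow K ι (n + 2)) :
    headComponent K n l (headComponent K (n + 1) k (braidAt r (n + 2) 0 f)) =
      ∑ u : ι × ι, r (k, l) u • headComponent K n u.2 (headComponent K (n + 1) u.1 f) := by
  funext w
  have h : 0 + 1 < n + 2 := by omega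
  have h0 : (⟨0, by omega⟩ : Fin (n + 2)) = 0 := rfl
  have h1 : (⟨0 + 1, h⟩ : Fin (n + 2)) = Fin.succ 0 := rfl
  simp only [headComponent_apply, braidAt, dif_pos h, LinearMap.coe_mk, AddHom.coe_mk,
    Finset.sum_apply, Pi.smul_apply, smul_eq_mul, h0, h1, Fin.cons_zero, Fin.cons_succ,
    Fin.update_cons_zero, ← Fin.cons_update]

lemma headComponent_prod_braidAt (r : Matrix (ι × ι) (ι × ι) K) (n : ℕ) (l : List ℕ) (k : ι)
    (f : TPow K ι (n + 1)) :
    headComponent K n k (((l.map (· + 1)).map (braidAt r (n + 1))).prod f) =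
      (l.map (braidAt r n)).prod (headComponent K n k f) := by
  induction l with
  | nil => rfl
  | cons i l ih =>
    simp only [List.map_cons, List.prod_cons, Module.End.mul_apply]
    rw [headComponent_braidAt_succ, ih]

/-- The sum of `s_0 s_1 ⋯ s_{m-1}` over all `m < n`: the sum, over the permutations that are
increasing except at one point, which they send to the first position, of the values of their
Matsumoto lifts. It is the right factor in `Q_{n+1} = (id ⊗ Q_n) firstShuffle`. -/
def firstShuffle (r : Matrix (ι × ι) (ι × ι) K) (n : ℕ) : Module.End K (TPow K ι n) :=
  ∑ m : Fin n, ((List.range m).map (braidAt r n)).prod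

lemma firstShuffle_one (r : Matrix (ι × ι) (ι × ι) K) : firstShuffle r 1 = 1 := by
  simp [firstShuffle]

lemma headComponent_firstShuffle (r : Matrix (ι × ι) (ι × ι) K) (n : ℕ) (k l : ι)
    (f : TPow K ι (n + 2)) :
    headComponent K n l (headComponent K (n + 1) k (firstShuffle r (n + 2) f)) =
      headComponent K n l (headComponent K (n + 1) k f) + ∑ u : ι × ι, r (k, l) u •
        headComponent K n u.2 (firstShuffle r (n + 1) (headComponent K (n + 1) u.1 f)) := by
  rw [firstShuffle, Fin.sum_univ_succ]
  simp only [Fin.val_zero, List.range_zero, List.map_nil, List.prod_nil, Fin.val_succ,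
    List.range_succ_eq_map, List.map_cons, List.prod_cons, LinearMap.add_apply,
    Module.End.one_apply, map_add, LinearMap.sum_apply, Module.End.mul_apply, map_sum,
    headComponent_braidAt_zero, firstShuffle, Finset.smul_sum]
  congr 1
  rw [Finset.sum_comm]
  refine Finset.sum_congr rfl fun u _ => Finset.sum_congr rfl fun m _ => ?_
  congr 2
  exact headComponent_prod_braidAt r (n + 1) _ _ _

/-- A permutation of `n + 1` points, split into the preimage of `0` and a permutation of `n` points,
as in the recursion of `reducedWord`. -/
def permUncons (n : ℕ) (σ : Equiv.Perm (Fin (n + 1))) : Fin (n + 1) × Equiv.Perm (Fin n) :=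
  (σ.symm 0,
    Equiv.removeNone ((finSuccEquiv' (σ.symm 0)).symm.trans (σ.trans (finSuccEquiv n))))

lemma permUncons_bijective (n : ℕ) : Function.Bijective (permUncons n) := by
  refine Function.Surjective.bijective_of_nat_card_le (fun ⟨m, τ⟩ => ?_)
    (by simp [Fintype.card_perm, Nat.factorial_succ])
  let σ : Equiv.Perm (Fin (n + 1)) :=
    (finSuccEquiv' m).trans ((Equiv.optionCongr τ).trans (finSuccEquiv n).symm)
  have hm : σ.symm 0 = m := by
    rw [Equiv.symm_apply_eq]
    simp [σ]
  have hτ : (finSuccEquiv' m).symm.trans (σ.trans (finSuccEquiv n)) = Equiv.optionCongr τ := by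
    ext1 y
    simp [σ]
  refine ⟨σ, Prod.ext hm ?_⟩
  rw [permUncons, hm, hτ, Equiv.removeNone_optionCongr]

lemma reducedWord_succ (n : ℕ) (σ : Equiv.Perm (Fin (n + 1))) :
    reducedWord (n + 1) σ =
      (reducedWord n (permUncons n σ).2).map (· + 1) ++ List.range (permUncons n σ).1 := rfl

lemma headComponent_quantumSymmetrizer (r : Matrix (ι × ι) (ι × ι) K) (n : ℕ) (k : ι)
    (f : TPow K ι (n + 1)) :
    headComponent K n k (quantumSymmetrizer r (n + 1) f) =
      quantumSymmetrizer r n (headComponent K n k (firstShuffle r (n + 1) f)) := by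
  simp only [quantumSymmetrizer, matsumoto, firstShuffle, reducedWord_succ, List.map_append,
    List.prod_append, LinearMap.sum_apply, map_sum, Module.End.mul_apply,
    headComponent_prod_braidAt]
  rw [Finset.sum_comm, ← Fintype.sum_prod_type_right']
  exact (permUncons_bijective n).sum_comp fun x => ((reducedWord n x.2).map (braidAt r n)).prod
    (headComponent K n k (((List.range x.1).map (braidAt r (n + 1))).prod f))

lemma quantumSymmetrizer_zero (r : Matrix (ι × ι) (ι × ι) K) : quantumSymmetrizer r 0 = 1 := by
  simp [quantumSymmetrizer, matsumoto, reducedWord]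

lemma quantumSymmetrizer_one (r : Matrix (ι × ι) (ι × ι) K) : quantumSymmetrizer r 1 = 1 := by
  simp [quantumSymmetrizer, matsumoto, reducedWord]

variable [DecidableEq ι]

lemma toFree_zero (f : TPow K ι 0) : toFree K ι 0 f = algebraMap K _ (f Fin.elim0) := by
  simp [toFree, Fintype.linearCombination_apply, Algebra.algebraMap_eq_smul_one,
    Subsingleton.elim default (Fin.elim0 : Fin 0 → ι)]

lemma toFree_succ (n : ℕ) (f : TPow K ι (n + 1)) :
    toFree K ι (n + 1) f =
      ∑ k, FreeAlgebra.ι K k * toFree K ι n (headComponent K n k f) := by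
  simp only [toFree, Fintype.linearCombination_apply, Finset.mul_sum, headComponent_apply]
  rw [← Fintype.sum_prod_type', ← (Fin.consEquiv fun _ : Fin (n + 1) => ι).sum_comp]
  refine Finset.sum_congr rfl fun x _ => ?_
  simp [Fin.consEquiv, List.ofFn_succ]

lemma gen_mul_toFree (n : ℕ) (j : ι) (f : TPow K ι n) :
    FreeAlgebra.ι K j * toFree K ι n f =
      toFree K ι (n + 1) fun w => if w 0 = j then f (Fin.tail w) else 0 := by
  have hhead (k : ι) : headComponent K n k (fun w => if w 0 = j then f (Fin.tail w) else 0) =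
      if k = j then f else 0 := by
    funext w
    by_cases hk : k = j <;> simp [headComponent_apply, hk]
  rw [toFree_succ, Finset.sum_eq_single j] <;> simp +contextual [hhead]

end Symmetrizer

section Generators

variable {K ι : Type*}

lemma eq_top_of_gen_mul_mem {A : Type*} [CommSemiring K] [Semiring A] [Algebra K A] {x : ι → A}
    (hx : Algebra.adjoin K (Set.range x) = ⊤) {S : Submodule K A} (h1 : 1 ∈ S)
    (hmul : ∀ j, ∀ y ∈ S, x j * y ∈ S) : S = ⊤ := by
  rw [eq_top_iff, ← Algebra.top_toSubmodule, ← hx, Algebra.adjoin_eq_span, Submodule.span_le]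
  intro y hy
  induction hy using Submonoid.closure_induction_left with
  | one => exact h1
  | mul_left _ hg y _ ih =>
    obtain ⟨j, rfl⟩ := hg
    exact hmul j y ih

lemma iSup_range_toFree [Field K] [Fintype ι] [DecidableEq ι] :
    ⨆ n, LinearMap.range (toFree K ι n) = ⊤ := by
  refine eq_top_of_gen_mul_mem (FreeAlgebra.adjoin_range_ι K ι)
    (Submodule.mem_iSup_of_mem 0 ⟨fun _ => 1, by simp [toFree_zero]⟩) fun j => ?_
  suffices (⨆ n, LinearMap.range (toFree K ι n)) ≤
      (⨆ n, LinearMap.range (toFree K ι n)).comap (LinearMap.mulLeft K (FreeAlgebra.ι K j)) from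
    this
  refine iSup_le fun n => ?_
  rintro _ ⟨f, rfl⟩
  exact Submodule.mem_iSup_of_mem (n + 1) ⟨_, (gen_mul_toFree n j f).symm⟩

end Generators

section SkewDerivations

variable {K : Type*} [Field K] {ι A : Type*} [Ring A] [Algebra K A]

/-- Linear maps `d k` on an algebra with elements `x i` and a character `ε` that vanishes on them,
where `d k` obeys the braided Leibniz rule
`d k (x_j y) = δ_{jk} y + ∑ r^{ji}_{kl} x_l (d i y)`. On `T(V)` these are the contractions of the
braided coproduct with the dual basis. -/
structure SkewDerivations [Fintype ι] [DecidableEq ι] (r : Matrix (ι × ι) (ι × ι) K) (x : ι → A)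
    (d : ι → A →ₗ[K] A) (ε : A →ₐ[K] K) : Prop where
  map_one : ∀ k, d k 1 = 0
  map_gen_mul : ∀ k j y, d k (x j * y) =
    (if j = k then y else 0) + ∑ l, ∑ i, r (k, l) (j, i) • (x l * d i y)
  counit_gen : ∀ j, ε (x j) = 0

/-- The functional `ε ∘ d k_n ∘ ⋯ ∘ d k_1`, whose values on an element of the tensor algebra are the
coordinates of its quantum symmetrization. -/
def iterDer (d : ι → A →ₗ[K] A) (ε : A →ₐ[K] K) : List ι → A →ₗ[K] K
  | [] => ε.toLinearMap
  | k :: w => (iterDer d ε w).comp (d k)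

/-- The largest subspace of the kernel of `ε` that is stable under the maps `d k`. -/
def radical (d : ι → A →ₗ[K] A) (ε : A →ₐ[K] K) : Submodule K A :=
  ⨅ w, LinearMap.ker (iterDer d ε w)

section Radical

variable {d : ι → A →ₗ[K] A} {ε : A →ₐ[K] K}

lemma mem_radical {y : A} : y ∈ radical d ε ↔ ∀ w, iterDer d ε w y = 0 := by
  simp [radical]

lemma radical_le_comap (k : ι) : radical d ε ≤ (radical d ε).comap (d k) :=
  fun _ hy => mem_radical.2 fun w => mem_radical.1 hy (k :: w)

lemma counit_eq_zero_of_mem_radical {y : A} (hy : y ∈ radical d ε) : ε y = 0 :=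
  mem_radical.1 hy []

end Radical

variable [Fintype ι] [DecidableEq ι] {r : Matrix (ι × ι) (ι × ι) K} {x : ι → A}
  {d : ι → A →ₗ[K] A} {ε : A →ₐ[K] K}

namespace SkewDerivations

lemma map_gen (h : SkewDerivations r x d ε) (k j : ι) : d k (x j) = if j = k then 1 else 0 := by
  simpa [h.map_one] using h.map_gen_mul k j 1

lemma map_lift_toFree (h : SkewDerivations r x d ε) (n : ℕ) (k : ι) (f : TPow K ι (n + 1)) :
    d k (FreeAlgebra.lift K x (toFree K ι (n + 1) f)) =
      FreeAlgebra.lift K x (toFree K ι n (headComponent K n k (firstShuffle r (n + 1) f))) := by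
  induction n generalizing k with
  | zero =>
    simp [toFree_succ, toFree_zero, firstShuffle_one, Algebra.algebraMap_eq_smul_one,
      h.map_gen]
  | succ n ih =>
    rw [toFree_succ (n + 1)]
    simp only [map_sum, map_mul, FreeAlgebra.lift_ι_apply, h.map_gen_mul, ih,
      Finset.sum_add_distrib, Finset.sum_ite_eq', Finset.mem_univ, if_true]
    rw [toFree_succ n, toFree_succ n]
    simp only [map_sum, map_mul, FreeAlgebra.lift_ι_apply, headComponent_firstShuffle, map_add,
      mul_add, Finset.sum_add_distrib, map_smul]
    congr 1
    rw [Finset.sum_comm]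
    refine Finset.sum_congr rfl fun l _ => ?_
    simp only [Fintype.sum_prod_type, Finset.mul_sum, mul_smul_comm]

lemma iterDer_lift_toFree (h : SkewDerivations r x d ε) (n : ℕ) (f : TPow K ι n) (w : Fin n → ι) :
    iterDer d ε (List.ofFn w) (FreeAlgebra.lift K x (toFree K ι n f)) =
      quantumSymmetrizer r n f w := by
  induction n with
  | zero =>
    rw [Subsingleton.elim w Fin.elim0]
    simp [iterDer, toFree_zero, quantumSymmetrizer_zero]
  | succ n ih =>
    rw [List.ofFn_succ, iterDer, LinearMap.comp_apply, h.map_lift_toFree]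
    refine (ih _ (Fin.tail w)).trans ?_
    rw [← headComponent_quantumSymmetrizer, headComponent_apply, Fin.cons_self_tail]

lemma iterDer_lift_toFree_of_ne (h : SkewDerivations r x d ε) (n : ℕ) (f : TPow K ι n)
    (w : List ι) (hw : w.length ≠ n) :
    iterDer d ε w (FreeAlgebra.lift K x (toFree K ι n f)) = 0 := by
  induction w generalizing n with
  | nil =>
    obtain ⟨n, rfl⟩ := Nat.exists_eq_succ_of_ne_zero hw.symm
    simp [iterDer, toFree_succ, h.counit_gen]
  | cons k w ih =>
    rw [iterDer, LinearMap.comp_apply]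
    cases n with
    | zero => simp [toFree_zero, Algebra.algebraMap_eq_smul_one, h.map_one]
    | succ n =>
      rw [h.map_lift_toFree]
      exact ih n _ (by simpa using hw)

lemma defRel_le (h : SkewDerivations r x d ε) :
    defRel r ≤ (radical d ε).comap (FreeAlgebra.lift K x).toLinearMap := by
  refine iSup₂_le fun n _ => ?_
  rintro _ ⟨f, hf, rfl⟩
  refine mem_radical.2 fun w => ?_
  by_cases hw : w.length = n
  · subst hw
    have hcoord := h.iterDer_lift_toFree w.length f w.get
    rwa [List.ofFn_get, LinearMap.mem_ker.1 hf] at hcoord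
  · exact h.iterDer_lift_toFree_of_ne n f w hw

lemma le_defRel (h : SkewDerivations r x d ε) :
    (radical d ε).comap (FreeAlgebra.lift K x).toLinearMap ≤ defRel r := by
  intro y hy
  obtain ⟨g, hg, rfl⟩ := (Submodule.mem_iSup_iff_exists_finsupp _ _).1
    (iSup_range_toFree (K := K) (ι := ι) ▸ Submodule.mem_top : y ∈ ⨆ n, _)
  choose f hf using hg
  have hQ (n : ℕ) : quantumSymmetrizer r n (f n) = 0 := by
    funext w
    have hcoord := mem_radical.1 hy (List.ofFn w)
    rw [AlgHom.toLinearMap_apply, Finsupp.sum, map_sum, map_sum, Finset.sum_eq_single n] at hcoord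
    · rwa [← hf, h.iterDer_lift_toFree] at hcoord
    · intro m _ hm
      rw [← hf]
      exact h.iterDer_lift_toFree_of_ne _ _ _ (by simpa using hm.symm)
    · intro hn
      rw [Finsupp.notMem_support_iff.1 hn, map_zero, map_zero]
  refine Submodule.sum_mem _ fun n _ => ?_
  by_cases hn : 2 ≤ n
  · exact Submodule.mem_iSup_of_mem n (Submodule.mem_iSup_of_mem hn ⟨f n, hQ n, hf n⟩)
  · have hQ1 : quantumSymmetrizer r n = 1 := by
      interval_cases n
      exacts [quantumSymmetrizer_zero r, quantumSymmetrizer_one r]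
    have hfn : f n = 0 := by simpa [hQ1] using hQ n
    suffices g n = 0 from this ▸ zero_mem _
    rw [← hf, hfn, map_zero]

theorem defRel_eq (h : SkewDerivations r x d ε) :
    defRel r = (radical d ε).comap (FreeAlgebra.lift K x).toLinearMap :=
  h.defRel_le.antisymm h.le_defRel

end SkewDerivations

end SkewDerivations

section SkewOperators

variable {K : Type*} [Field K] {ι : Type*} [Fintype ι] [DecidableEq ι]
variable {A : Type*} [Ring A] [Algebra K A]

/-- The operator on `A × (ι → A)` through which left multiplication by `x j` acts on the pairs
`(y, (d_i y)_i)`, for skew derivations `d`. -/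
def skewOp (r : Matrix (ι × ι) (ι × ι) K) (x : ι → A) (j : ι) : Module.End K (A × (ι → A)) where
  toFun v := (x j * v.1,
    fun k => (if j = k then v.1 else 0) + ∑ l, ∑ i, r (k, l) (j, i) • (x l * v.2 i))
  map_add' v w := by
    refine Prod.ext (mul_add _ _ _) (funext fun k => ?_)
    simp only [Prod.fst_add, Prod.snd_add, Pi.add_apply, mul_add, smul_add,
      Finset.sum_add_distrib]
    split_ifs <;> abel
  map_smul' c v := by
    refine Prod.ext (by simp) (funext fun k => ?_)
    simp [Finset.smul_sum, smul_comm c]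

lemma skewOp_apply (r : Matrix (ι × ι) (ι × ι) K) (x : ι → A) (j : ι) (v : A × (ι → A)) :
    skewOp r x j v = (x j * v.1,
      fun k => (if j = k then v.1 else 0) + ∑ l, ∑ i, r (k, l) (j, i) • (x l * v.2 i)) := rfl

lemma SkewDerivations.skewOp_jet {r : Matrix (ι × ι) (ι × ι) K} {x : ι → A} {d : ι → A →ₗ[K] A}
    {ε : A →ₐ[K] K} (h : SkewDerivations r x d ε) (j : ι) (y : A) :
    skewOp r x j (y, fun i => d i y) = (x j * y, fun i => d i (x j * y)) := by
  simp only [skewOp_apply, h.map_gen_mul]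

lemma exists_skewDerivations {r : Matrix (ι × ι) (ι × ι) K} {x : ι → A}
    (hx : Algebra.adjoin K (Set.range x) = ⊤) (Φ : A →ₐ[K] Module.End K (A × (ι → A)))
    (hΦ : ∀ j, Φ (x j) = skewOp r x j) (ε : A →ₐ[K] K) (hε : ∀ j, ε (x j) = 0) :
    ∃ d, SkewDerivations r x d ε := by
  let jet : A →ₗ[K] A × (ι → A) := (LinearMap.applyₗ (1, 0)).comp Φ.toLinearMap
  have jet_gen_mul (j : ι) (y : A) : jet (x j * y) = skewOp r x j (jet y) := by
    simp [jet, hΦ]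
  have jet_fst (y : A) : (jet y).1 = y := by
    have htop : LinearMap.eqLocus (LinearMap.fst K A (ι → A) ∘ₗ jet) LinearMap.id = ⊤ := by
      refine eq_top_of_gen_mul_mem hx (by simp [jet]) fun j y hy => ?_
      have hy : (jet y).1 = y := hy
      simp [jet_gen_mul, skewOp_apply, hy]
    exact htop.ge (Submodule.mem_top (x := y))
  refine ⟨fun k => LinearMap.proj k ∘ₗ LinearMap.snd K A (ι → A) ∘ₗ jet, ?_, fun k j y => ?_, hε⟩
  · simp [jet]
  · simp [jet_gen_mul, skewOp_apply, jet_fst]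

end SkewOperators

section Quotient

variable {K : Type*} [Field K] {ι : Type*}

lemma span_coe_eq {R : Type*} [Ring R] (I : TwoSidedIdeal R) : TwoSidedIdeal.span (I : Set R) = I :=
  le_antisymm (TwoSidedIdeal.span_le.2 subset_rfl) TwoSidedIdeal.subset_span

/-- The class of the generator `x_i` in the quotient of the free algebra by a two-sided ideal. -/
def quotientGen (I : TwoSidedIdeal (FreeAlgebra K ι)) (i : ι) : FreeAlgebra K ι ⧸ I.asIdeal :=
  Ideal.Quotient.mk I.asIdeal (FreeAlgebra.ι K i)

lemma lift_quotientGen (I : TwoSidedIdeal (FreeAlgebra K ι)) (u : FreeAlgebra K ι) :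
    FreeAlgebra.lift K (quotientGen I) u = Ideal.Quotient.mk I.asIdeal u := by
  have h : FreeAlgebra.lift K (quotientGen I) = Ideal.Quotient.mkₐ K I.asIdeal :=
    FreeAlgebra.hom_ext (by ext; simp [quotientGen])
  rw [h]
  rfl

lemma lift_quotientGen_eq_zero_iff (I : TwoSidedIdeal (FreeAlgebra K ι)) (u : FreeAlgebra K ι) :
    FreeAlgebra.lift K (quotientGen I) u = 0 ↔ u ∈ I := by
  rw [lift_quotientGen, Ideal.Quotient.eq_zero_iff_mem, TwoSidedIdeal.mem_asIdeal]

lemma adjoin_quotientGen (I : TwoSidedIdeal (FreeAlgebra K ι)) :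
    Algebra.adjoin K (Set.range (quotientGen I)) = ⊤ := by
  have h : Set.range (quotientGen I) =
      Ideal.Quotient.mkₐ K I.asIdeal '' Set.range (FreeAlgebra.ι K) := by
    rw [← Set.range_comp]
    rfl
  rw [h, ← AlgHom.map_adjoin, FreeAlgebra.adjoin_range_ι, Algebra.map_top,
    AlgHom.range_eq_top]
  exact Ideal.Quotient.mkₐ_surjective K I.asIdeal

lemma exists_skewDerivations_quotientGen [Fintype ι] [DecidableEq ι]
    (r : Matrix (ι × ι) (ι × ι) K) (I : TwoSidedIdeal (FreeAlgebra K ι))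
    (hop : ∀ u ∈ I, FreeAlgebra.lift K (skewOp r (quotientGen I)) u = 0)
    (hzero : ∀ u ∈ I, FreeAlgebra.lift K (fun _ : ι => (0 : K)) u = 0) :
    ∃ d ε, SkewDerivations r (quotientGen I) d ε := by
  obtain ⟨d, hd⟩ := exists_skewDerivations (adjoin_quotientGen I)
    (Ideal.Quotient.liftₐ I.asIdeal (FreeAlgebra.lift K (skewOp r (quotientGen I)))
      fun u hu => hop u (TwoSidedIdeal.mem_asIdeal.1 hu))
    (fun j => FreeAlgebra.lift_ι_apply (R := K) _ j)
    (Ideal.Quotient.liftₐ I.asIdeal (FreeAlgebra.lift K fun _ : ι => (0 : K))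
      fun u hu => hzero u (TwoSidedIdeal.mem_asIdeal.1 hu))
    (fun j => FreeAlgebra.lift_ι_apply (R := K) _ j)
  exact ⟨d, _, hd⟩

lemma defRel_eq_of_radical_eq_bot [Fintype ι] [DecidableEq ι] {r : Matrix (ι × ι) (ι × ι) K}
    {I : TwoSidedIdeal (FreeAlgebra K ι)} {d : ι → FreeAlgebra K ι ⧸ I.asIdeal →ₗ[K] _}
    {ε : FreeAlgebra K ι ⧸ I.asIdeal →ₐ[K] K} (h : SkewDerivations r (quotientGen I) d ε)
    (hd : radical d ε = ⊥) : (defRel r : Set (FreeAlgebra K ι)) = I := by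
  ext u
  rw [h.defRel_eq, hd]
  exact lift_quotientGen_eq_zero_iff I u

end Quotient

section Braiding

variable {K : Type*} [Field K] {A : Type*} [Ring A] [Algebra K A]

/-- The relations that hold in the Nichols algebra of `R_{1,5}` with `t = -1` and `p = 0` for all
values of the other parameters, as rules that rewrite words to ordered monomials. -/
structure QuadraticRelations (ℓ q : K) (x : Fin 3 → A) : Prop where
  zero_mul_zero : x 0 * x 0 = 0
  one_mul_zero : x 1 * x 0 = -(x 0 * x 1)
  one_mul_one : x 1 * x 1 = ℓ • (x 0 * x 1)
  two_mul_zero : x 2 * x 0 = -(x 0 * x 2)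
  two_mul_one : x 2 * x 1 = -(x 1 * x 2) + ℓ • (x 0 * x 2) - q • (x 0 * x 1)

namespace QuadraticRelations

variable {ℓ q : K} {x : Fin 3 → A} (h : QuadraticRelations ℓ q x) (y : A)
include h

lemma zero_mul_zero_mul : x 0 * (x 0 * y) = 0 := by rw [← mul_assoc, h.zero_mul_zero, zero_mul]

lemma one_mul_zero_mul : x 1 * (x 0 * y) = -(x 0 * (x 1 * y)) := by
  rw [← mul_assoc, h.one_mul_zero, neg_mul, mul_assoc]

lemma one_mul_one_mul : x 1 * (x 1 * y) = ℓ • (x 0 * (x 1 * y)) := by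
  rw [← mul_assoc, h.one_mul_one, smul_mul_assoc, mul_assoc]

lemma two_mul_zero_mul : x 2 * (x 0 * y) = -(x 0 * (x 2 * y)) := by
  rw [← mul_assoc, h.two_mul_zero, neg_mul, mul_assoc]

lemma two_mul_one_mul : x 2 * (x 1 * y) =
    -(x 1 * (x 2 * y)) + ℓ • (x 0 * (x 2 * y)) - q • (x 0 * (x 1 * y)) := by
  rw [← mul_assoc, h.two_mul_one]
  simp only [sub_mul, add_mul, neg_mul, smul_mul_assoc, mul_assoc]

end QuadraticRelations

/-- The element `x_3^2 + b x_1 x_2`: it vanishes in the Nichols algebra if `a = b ℓ`, and its powers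
are linearly independent otherwise. -/
def deformedSquare (b : K) (x : Fin 3 → A) : A := x 2 * x 2 + b • (x 0 * x 1)

lemma deformedSquare_mul (b : K) (x : Fin 3 → A) (y : A) :
    deformedSquare b x * y = x 2 * (x 2 * y) + b • (x 0 * (x 1 * y)) := by
  simp only [deformedSquare, add_mul, smul_mul_assoc, mul_assoc]

lemma QuadraticRelations.deformedSquare_mul_zero_mul {ℓ q : K} {x : Fin 3 → A}
    (h : QuadraticRelations ℓ q x) (b : K) (y : A) :
    deformedSquare b x * (x 0 * y) = x 0 * (deformedSquare b x * y) := by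
  simp only [deformedSquare_mul, mul_add, mul_smul_comm, h.zero_mul_zero_mul, h.one_mul_zero_mul,
    h.two_mul_zero_mul, mul_neg, neg_neg, smul_zero, neg_zero]

section SkewOp

variable (a b k ℓ q : K) (x : Fin 3 → A) (y y₀ y₁ y₂ : A)

lemma skewOp_braiding15_zero :
    skewOp (braiding15 (-1) 0 a b k ℓ q) x 0 (y, ![y₀, y₁, y₂]) =
      (x 0 * y, ![y - x 0 * y₀ + ℓ • (x 0 * y₁), -(x 0 * y₁), -(x 0 * y₂)]) := by
  rw [skewOp_apply]
  refine Prod.ext rfl (funext fun i => ?_)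
  fin_cases i <;> simp [Fin.sum_univ_three, braiding15, R15, finProdFinEquiv]
  module

lemma skewOp_braiding15_one :
    skewOp (braiding15 (-1) 0 a b k ℓ q) x 1 (y, ![y₀, y₁, y₂]) =
      (x 1 * y,
        ![-(x 1 * y₀) - ℓ • (x 0 * y₀) + ℓ • (x 1 * y₁) + ℓ ^ 2 • (x 0 * y₁)
            - q • (x 1 * y₂) - k • (x 0 * y₂),
          y - x 1 * y₁ - ℓ • (x 0 * y₁) + q • (x 0 * y₂),
          -(x 1 * y₂) - ℓ • (x 0 * y₂)]) := by
  rw [skewOp_apply]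
  refine Prod.ext rfl (funext fun i => ?_)
  fin_cases i <;> simp [Fin.sum_univ_three, braiding15, R15, finProdFinEquiv] <;> module

lemma skewOp_braiding15_two :
    skewOp (braiding15 (-1) 0 a b k ℓ q) x 2 (y, ![y₀, y₁, y₂]) =
      (x 2 * y,
        ![-(x 2 * y₀) + ℓ • (x 2 * y₁) - (ℓ * q - k) • (x 0 * y₁)
            - b • (x 1 * y₂) - a • (x 0 * y₂),
          -(x 2 * y₁) + b • (x 0 * y₂),
          y - x 2 * y₂]) := by
  rw [skewOp_apply]
  refine Prod.ext rfl (funext fun i => ?_)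
  fin_cases i <;> simp [Fin.sum_univ_three, braiding15, R15, finProdFinEquiv] <;> module

variable {x}

lemma deformedSquare_skewOp {ℓ q : K} (h : QuadraticRelations ℓ q x) :
    deformedSquare b (skewOp (braiding15 (-1) 0 a b k ℓ q) x) (y, ![y₀, y₁, y₂]) =
      (deformedSquare b x * y,
        ![(b * ℓ - a) • (x 0 * y) + deformedSquare b x * y₀ - (2 * ℓ) • (deformedSquare b x * y₁),
          deformedSquare b x * y₁, deformedSquare b x * y₂]) := by
  simp only [deformedSquare, LinearMap.add_apply, LinearMap.smul_apply, Module.End.mul_apply,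
    skewOp_braiding15_zero, skewOp_braiding15_one, skewOp_braiding15_two, Prod.smul_mk,
    Prod.mk_add_mk, Matrix.smul_cons, Matrix.smul_empty, Matrix.cons_add_cons,
    Matrix.empty_add_empty, add_mul, smul_mul_assoc, mul_assoc, mul_add, mul_sub, mul_neg,
    mul_smul_comm, h.zero_mul_zero_mul, h.two_mul_zero_mul, h.two_mul_one_mul]
  refine congrArg₂ Prod.mk ?_ (Matrix.vec3_eq ?_ ?_ ?_) <;> module

lemma linearMap_jet_ext {f g : Module.End K (A × (Fin 3 → A))}
    (hfg : ∀ y y₀ y₁ y₂, f (y, ![y₀, y₁, y₂]) = g (y, ![y₀, y₁, y₂])) : f = g :=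
  LinearMap.ext fun ⟨y, v⟩ => by
    rw [← FinVec.etaExpand_eq v]
    exact hfg y _ _ _

lemma quadraticRelations_skewOp {ℓ q : K} (h : QuadraticRelations ℓ q x) :
    QuadraticRelations ℓ q (skewOp (braiding15 (-1) 0 a b k ℓ q) x) := by
  constructor <;> refine linearMap_jet_ext fun y y₀ y₁ y₂ => ?_
  case zero_mul_zero =>
    simp [skewOp_braiding15_zero, mul_add, mul_sub, h.zero_mul_zero_mul]
  all_goals
    simp only [LinearMap.add_apply, LinearMap.sub_apply, LinearMap.neg_apply,
      LinearMap.smul_apply, Module.End.mul_apply, skewOp_braiding15_zero, skewOp_braiding15_one,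
      skewOp_braiding15_two, Prod.smul_mk, Prod.neg_mk, Prod.mk_add_mk, Prod.mk_sub_mk,
      Matrix.smul_cons, Matrix.smul_empty, Matrix.neg_cons, Matrix.neg_empty,
      Matrix.cons_add_cons, Matrix.cons_sub_cons, Matrix.empty_add_empty, Matrix.empty_sub_empty,
      mul_add, mul_sub, mul_neg, mul_smul_comm, h.zero_mul_zero_mul, h.one_mul_zero_mul,
      h.one_mul_one_mul, h.two_mul_zero_mul, h.two_mul_one_mul]
    refine congrArg₂ Prod.mk ?_ (Matrix.vec3_eq ?_ ?_ ?_) <;> module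

end SkewOp

end Braiding

section LinearIndependence

lemma linearIndependent_sumElim_of_map {K V W J J' : Type*} [Ring K] [AddCommGroup V]
    [Module K V] [AddCommGroup W] [Module K W] (D : V →ₗ[K] W) {f : J → V} {g : J' → V}
    (hf : LinearIndependent K f) (hDf : ∀ j, D (f j) = 0) (hg : LinearIndependent K (D ∘ g)) :
    LinearIndependent K (Sum.elim f g) := by
  have hker : Submodule.span K (Set.range f) ≤ LinearMap.ker D :=
    Submodule.span_le.2 (Set.range_subset_iff.2 hDf)
  exact hf.sum_type (hg.of_comp D) ((Submodule.range_ker_disjoint hg).symm.mono_left hker)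

lemma linearIndependent_of_chain {K V : Type*} [Field K] [AddCommGroup V] [Module K V]
    (D : Module.End K V) {e : ℕ → V} {c : ℕ → K} (he : e 0 ≠ 0) (hD0 : D (e 0) = 0)
    (hD : ∀ i, D (e (i + 1)) = c i • e i) {n : ℕ} (hc : ∀ i, i + 1 < n → c i ≠ 0) :
    LinearIndependent K fun i : Fin n => e i := by
  induction n with
  | zero => exact linearIndependent_empty_type
  | succ n ih =>
    have htail : LinearIndependent K (D ∘ fun i : Fin n => e (i + 1)) := by
      rw [show (D ∘ fun i : Fin n => e (i + 1)) = fun i : Fin n => c i • e i from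
        funext fun i => hD i]
      exact (ih fun i hi => hc i (by omega)).units_smul fun i => Units.mk0 (c i) (hc i (by omega))
    refine linearIndependent_finSucc.2 ⟨htail.of_comp D, fun h0 => he ?_⟩
    exact Submodule.disjoint_def.1 (Submodule.range_ker_disjoint htail) _ h0 hD0

end LinearIndependence

section Doubling

variable {K : Type*} [CommRing K] {A : Type*} [Ring A] [Algebra K A] {J : Type*}

/-- The family `f` together with its left multiple `y * f`. -/
def doubled (y : A) (f : J → A) : J ⊕ J → A := Sum.elim f fun j => y * f j

lemma linearIndependent_mkQ_doubled {N : Submodule K A} (D : A →ₗ[K] A) (hN : N ≤ N.comap D)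
    {y : A} {f : J → A} (hf : LinearIndependent K (N.mkQ ∘ f)) (hDf : ∀ j, D (f j) = 0)
    (hDy : ∀ j, D (y * f j) = f j) : LinearIndependent K (N.mkQ ∘ doubled y f) := by
  rw [doubled, Sum.comp_elim]
  refine linearIndependent_sumElim_of_map (N.mapQ N D hN) hf (fun j => ?_) ?_
  · simp [hDf]
  · have hDg : N.mapQ N D hN ∘ N.mkQ ∘ (fun j => y * f j) = N.mkQ ∘ f :=
      funext fun j => by simp [hDy]
    rwa [hDg]

end Doubling

section Independence

variable {K : Type*} [Field K] {A : Type*} [Ring A] [Algebra K A]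

/-- The sequence `1, x_1, z, x_1 z, z^2, x_1 z^2, …`, where `z = x_3^2 + b x_1 x_2`. If no
multiple of `b ℓ - a` vanishes, it is a Jordan chain, up to scalars, of the skew derivation `d_1` of
the Nichols algebra. -/
def jordanChain (b : K) (x : Fin 3 → A) (i : ℕ) : A :=
  x 0 ^ (i % 2) * deformedSquare b x ^ (i / 2)

lemma jordanChain_two_mul (b : K) (x : Fin 3 → A) (m : ℕ) :
    jordanChain b x (2 * m) = deformedSquare b x ^ m := by
  simp [jordanChain]

lemma jordanChain_two_mul_add_one (b : K) (x : Fin 3 → A) (m : ℕ) :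
    jordanChain b x (2 * m + 1) = x 0 * deformedSquare b x ^ m := by
  simp [jordanChain, Nat.mul_add_div]

variable {a b k ℓ q : K} {x : Fin 3 → A} {d : Fin 3 → A →ₗ[K] A} {ε : A →ₐ[K] K}

namespace SkewDerivations

variable (hd : SkewDerivations (braiding15 (-1) 0 a b k ℓ q) x d ε)
include hd

lemma skewOp_vec_jet (j : Fin 3) (y : A) :
    skewOp (braiding15 (-1) 0 a b k ℓ q) x j (y, ![d 0 y, d 1 y, d 2 y]) =
      (x j * y, ![d 0 (x j * y), d 1 (x j * y), d 2 (x j * y)]) := by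
  have hvec (u : A) : (fun i => d i u) = ![d 0 u, d 1 u, d 2 u] := (FinVec.etaExpand_eq _).symm
  rw [← hvec, ← hvec, hd.skewOp_jet]

lemma map_zero_mul (y : A) :
    d 0 (x 0 * y) = y - x 0 * d 0 y + ℓ • (x 0 * d 1 y) ∧
      d 1 (x 0 * y) = -(x 0 * d 1 y) ∧ d 2 (x 0 * y) = -(x 0 * d 2 y) := by
  simpa [skewOp_braiding15_zero, eq_comm] using hd.skewOp_vec_jet 0 y

lemma map_one_mul (y : A) :
    d 1 (x 1 * y) = y - x 1 * d 1 y - ℓ • (x 0 * d 1 y) + q • (x 0 * d 2 y) ∧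
      d 2 (x 1 * y) = -(x 1 * d 2 y) - ℓ • (x 0 * d 2 y) := by
  have h := hd.skewOp_vec_jet 1 y
  simp only [skewOp_braiding15_one, Prod.mk.injEq, Matrix.vecCons_inj] at h
  exact ⟨h.2.2.1.symm, h.2.2.2.1.symm⟩

lemma map_two_mul (y : A) : d 2 (x 2 * y) = y - x 2 * d 2 y := by
  have h := hd.skewOp_vec_jet 2 y
  simp only [skewOp_braiding15_two, Prod.mk.injEq, Matrix.vecCons_inj] at h
  exact h.2.2.2.1.symm

lemma map_deformedSquare_mul (h : QuadraticRelations ℓ q x) (y : A) :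
    d 0 (deformedSquare b x * y) = (b * ℓ - a) • (x 0 * y) + deformedSquare b x * d 0 y
        - (2 * ℓ) • (deformedSquare b x * d 1 y) ∧
      d 1 (deformedSquare b x * y) = deformedSquare b x * d 1 y ∧
      d 2 (deformedSquare b x * y) = deformedSquare b x * d 2 y := by
  have hjet := deformedSquare_skewOp a b k y (d 0 y) (d 1 y) (d 2 y) h
  have hjet' : deformedSquare b (skewOp (braiding15 (-1) 0 a b k ℓ q) x)
      (y, ![d 0 y, d 1 y, d 2 y]) = (deformedSquare b x * y, ![d 0 (deformedSquare b x * y),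
        d 1 (deformedSquare b x * y), d 2 (deformedSquare b x * y)]) := by
    simp only [deformedSquare_mul]
    simp [deformedSquare, hd.skewOp_vec_jet]
  simp only [hjet', Prod.mk.injEq, Matrix.vecCons_inj] at hjet
  exact ⟨hjet.2.1, hjet.2.2.1, hjet.2.2.2.1⟩

lemma map_deformedSquare_pow (h : QuadraticRelations ℓ q x) (m : ℕ) :
    d 0 (deformedSquare b x ^ (m + 1)) =
        ((m + 1 : ℕ) * (b * ℓ - a)) • (x 0 * deformedSquare b x ^ m) ∧
      d 1 (deformedSquare b x ^ (m + 1)) = 0 ∧ d 2 (deformedSquare b x ^ (m + 1)) = 0 := by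
  induction m with
  | zero =>
    simpa only [hd.map_one, mul_one, mul_zero, smul_zero, add_zero, sub_zero, zero_add, pow_one,
      pow_zero, Nat.cast_one, one_mul] using hd.map_deformedSquare_mul h 1
  | succ m ih =>
    obtain ⟨h0, h1, h2⟩ := hd.map_deformedSquare_mul h (deformedSquare b x ^ (m + 1))
    rw [← pow_succ', ih.1, ih.2.1, mul_smul_comm, h.deformedSquare_mul_zero_mul, ← pow_succ',
      mul_zero, smul_zero, sub_zero] at h0
    rw [← pow_succ', ih.2.1, mul_zero] at h1
    rw [← pow_succ', ih.2.2, mul_zero] at h2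
    refine ⟨?_, h1, h2⟩
    rw [h0]
    push_cast
    module

lemma map_deformedSquare_pow_eq_zero (h : QuadraticRelations ℓ q x) (m : ℕ) :
    d 1 (deformedSquare b x ^ m) = 0 ∧ d 2 (deformedSquare b x ^ m) = 0 := by
  cases m with
  | zero => simp [hd.map_one]
  | succ m => exact (hd.map_deformedSquare_pow h m).2

lemma map_jordanChain_eq_zero (h : QuadraticRelations ℓ q x) (i : ℕ) :
    d 1 (jordanChain b x i) = 0 ∧ d 2 (jordanChain b x i) = 0 := by
  obtain ⟨m, rfl | rfl⟩ := i.even_or_odd'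
  · rw [jordanChain_two_mul]
    exact hd.map_deformedSquare_pow_eq_zero h m
  · obtain ⟨h1, h2⟩ := hd.map_deformedSquare_pow_eq_zero h m
    obtain ⟨-, h1', h2'⟩ := hd.map_zero_mul (deformedSquare b x ^ m)
    rw [jordanChain_two_mul_add_one, h1', h2', h1, h2]
    simp

lemma map_zero_jordanChain_succ (h : QuadraticRelations ℓ q x) (i : ℕ) :
    d 0 (jordanChain b x (i + 1)) =
      (if Even i then 1 else (i / 2 + 1 : ℕ) * (b * ℓ - a)) • jordanChain b x i := by
  obtain ⟨m, rfl | rfl⟩ := i.even_or_odd'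
  · have hx0 : x 0 * d 0 (deformedSquare b x ^ m) = 0 := by
      cases m with
      | zero => simp [hd.map_one]
      | succ m =>
        rw [(hd.map_deformedSquare_pow h m).1, mul_smul_comm, h.zero_mul_zero_mul, smul_zero]
    rw [jordanChain_two_mul_add_one, jordanChain_two_mul, (hd.map_zero_mul _).1, hx0,
      (hd.map_deformedSquare_pow_eq_zero h m).1]
    simp
  · rw [show 2 * m + 1 + 1 = 2 * (m + 1) by ring, jordanChain_two_mul, jordanChain_two_mul_add_one,
      (hd.map_deformedSquare_pow h m).1, if_neg (by simp), show (2 * m + 1) / 2 = m by omega]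

lemma linearIndependent_mkQ_jordanChain (h : QuadraticRelations ℓ q x) {n : ℕ}
    (hn : ∀ m : ℕ, 0 < m → m ≤ n → (m : K) * (b * ℓ - a) ≠ 0) :
    LinearIndependent K ((radical d ε).mkQ ∘ fun i : Fin (2 * n + 2) => jordanChain b x i) := by
  refine linearIndependent_of_chain ((radical d ε).mapQ _ (d 0) (radical_le_comap 0))
    (e := fun i => (radical d ε).mkQ (jordanChain b x i))
    (c := fun i => if Even i then 1 else (i / 2 + 1 : ℕ) * (b * ℓ - a)) ?_ ?_ (fun i => ?_)
    fun i hi => ?_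
  · intro h0
    have h1 : (1 : A) ∈ radical d ε := by simpa [jordanChain] using h0
    simpa using counit_eq_zero_of_mem_radical h1
  · simp [jordanChain, hd.map_one]
  · simp only [Submodule.mkQ_apply, Submodule.mapQ_apply, hd.map_zero_jordanChain_succ h,
      Submodule.Quotient.mk_smul]
  · split_ifs with hi'
    · exact one_ne_zero
    · obtain ⟨m, rfl⟩ := Nat.not_even_iff_odd.1 hi'
      exact hn _ (by omega) (by omega)

lemma linearIndependent_mkQ_doubled_jordanChain (h : QuadraticRelations ℓ q x) {n : ℕ}
    (hn : ∀ m : ℕ, 0 < m → m ≤ n → (m : K) * (b * ℓ - a) ≠ 0) :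
    LinearIndependent K ((radical d ε).mkQ ∘
      doubled (x 2) (doubled (x 1) fun i : Fin (2 * n + 2) => jordanChain b x i)) := by
  have hchain (i : ℕ) := hd.map_jordanChain_eq_zero h i
  have hdouble (j) : d 2 (doubled (x 1) (fun i : Fin (2 * n + 2) => jordanChain b x i) j) = 0 := by
    rcases j with i | i
    · exact (hchain i).2
    · simp [doubled, hd.map_one_mul, hchain]
  exact linearIndependent_mkQ_doubled (d 2) (radical_le_comap 2)
    (linearIndependent_mkQ_doubled (d 1) (radical_le_comap 1)
      (hd.linearIndependent_mkQ_jordanChain h hn) (fun i => (hchain i).1)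
      fun i => by simp [hd.map_one_mul, hchain])
    hdouble fun j => by simp [hd.map_two_mul, hdouble]

end SkewDerivations

end Independence

section OrderedMonomials

variable {K : Type*} [Field K] {A : Type*} [Ring A] [Algebra K A]

/-- The ordered monomial `x_1^{e_1} x_2^{e_2} x_3^{e_3}`. -/
def monomial (x : Fin 3 → A) (e : Fin 3 → ℕ) : A := x 0 ^ e 0 * x 1 ^ e 1 * x 2 ^ e 2

/-- The exponents of the ordered monomials with `e_1, e_2 < 2` and `e_3 < h`, where `h = ⊤` means
that `e_3` is not restricted. -/
def exponents (h : ℕ∞) : Set (Fin 3 → ℕ) := {e | ∀ i, (e i : ℕ∞) < (![2, 2, h] : Fin 3 → ℕ∞) i}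

lemma mem_exponents {h : ℕ∞} {e : Fin 3 → ℕ} :
    e ∈ exponents h ↔ e 0 < 2 ∧ e 1 < 2 ∧ (e 2 : ℕ∞) < h := by
  simp [exponents, Fin.forall_fin_succ, Nat.cast_lt_ofNat]

lemma exponents_natCast (N : ℕ) :
    exponents N = Fintype.piFinset fun i => Finset.range (![2, 2, N] i) := by
  ext e
  simp [mem_exponents, Fin.forall_fin_succ]

lemma finite_exponents (N : ℕ) : (exponents N).Finite := by
  rw [exponents_natCast]
  exact Finset.finite_toSet _

lemma ncard_exponents (N : ℕ) : (exponents N).ncard = 4 * N := by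
  rw [exponents_natCast, Set.ncard_coe_finset, Fintype.card_piFinset]
  simp [Fin.prod_univ_three]

lemma exponents_mono {h h' : ℕ∞} (hh : h ≤ h') : exponents h ⊆ exponents h' := fun _ he =>
  mem_exponents.2 ((mem_exponents.1 he).imp_right (And.imp_right fun h2 => h2.trans_le hh))

lemma iUnion_exponents : ⋃ n : ℕ, exponents (2 * n + 2 : ℕ) = exponents ⊤ := by
  refine subset_antisymm (Set.iUnion_subset fun n => exponents_mono le_top) fun e he => ?_
  obtain ⟨h0, h1, -⟩ := mem_exponents.1 he
  exact Set.mem_iUnion.2 ⟨e 2, mem_exponents.2 ⟨h0, h1, Nat.cast_lt.2 (by omega)⟩⟩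

variable (K) in
/-- The span of the ordered monomials with exponents in `exponents h`. -/
def monomialSpan (x : Fin 3 → A) (h : ℕ∞) : Submodule K A :=
  Submodule.span K (monomial x '' exponents h)

variable {x : Fin 3 → A}

lemma isPBWBasis_iff {h : ℕ∞} : IsPBWBasis K x ![2, 2, h] ↔
    LinearIndepOn K (monomial x) (exponents h) ∧ monomialSpan K x h = ⊤ := by
  rw [monomialSpan, Set.image_eq_range]
  rfl

lemma monomialSpan_mono {h h' : ℕ∞} (hh : h ≤ h') : monomialSpan K x h ≤ monomialSpan K x h' :=
  Submodule.span_mono (Set.image_mono (exponents_mono hh))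

lemma monomialSpan_le_iff {h : ℕ∞} {S : Submodule K A} :
    monomialSpan K x h ≤ S ↔ ∀ n : ℕ, n < h →
      x 2 ^ n ∈ S ∧ x 0 * x 2 ^ n ∈ S ∧ x 1 * x 2 ^ n ∈ S ∧ x 0 * (x 1 * x 2 ^ n) ∈ S := by
  rw [monomialSpan, Submodule.span_le, Set.image_subset_iff]
  simp only [Set.subset_def, Set.mem_preimage, SetLike.mem_coe, mem_exponents, monomial]
  refine ⟨fun hS n hn => ⟨?_, ?_, ?_, ?_⟩, fun hS e he => ?_⟩
  · simpa using hS ![0, 0, n] (by simpa using hn)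
  · simpa using hS ![1, 0, n] (by simpa using hn)
  · simpa using hS ![0, 1, n] (by simpa using hn)
  · simpa [mul_assoc] using hS ![1, 1, n] (by simpa using hn)
  · obtain ⟨h0, h1, h2⟩ := he
    obtain ⟨m, m0, m1, m01⟩ := hS (e 2) h2
    interval_cases e 0 <;> interval_cases e 1 <;> simpa [mul_assoc]

lemma one_mem_monomialSpan {h : ℕ∞} (hh : 0 < h) : 1 ∈ monomialSpan K x h := by
  simpa using (monomialSpan_le_iff.1 (le_refl (monomialSpan K x h)) 0 hh).1

namespace QuadraticRelations

variable {ℓ q : K} (hx : QuadraticRelations ℓ q x) {h : ℕ∞} {u : A}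
include hx

lemma zero_mul_mem (hu : u ∈ monomialSpan K x h) : x 0 * u ∈ monomialSpan K x h := by
  suffices monomialSpan K x h ≤ (monomialSpan K x h).comap (LinearMap.mulLeft K (x 0)) from this hu
  refine monomialSpan_le_iff.2 fun n hn => ?_
  obtain ⟨-, m0, -, m01⟩ := monomialSpan_le_iff.1 (le_refl (monomialSpan K x h)) n hn
  simp [hx.zero_mul_zero_mul, m0, m01]

lemma one_mul_mem (hu : u ∈ monomialSpan K x h) : x 1 * u ∈ monomialSpan K x h := by
  suffices monomialSpan K x h ≤ (monomialSpan K x h).comap (LinearMap.mulLeft K (x 1)) from this hu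
  refine monomialSpan_le_iff.2 fun n hn => ?_
  obtain ⟨-, -, m1, m01⟩ := monomialSpan_le_iff.1 (le_refl (monomialSpan K x h)) n hn
  simp [hx.one_mul_zero_mul, hx.one_mul_one_mul, hx.zero_mul_zero_mul, m1, m01,
    Submodule.smul_mem]

lemma two_mul_mem (hu : u ∈ monomialSpan K x h) : x 2 * u ∈ monomialSpan K x (h + 1) := by
  suffices monomialSpan K x h ≤ (monomialSpan K x (h + 1)).comap (LinearMap.mulLeft K (x 2)) from
    this hu
  refine monomialSpan_le_iff.2 fun n hn => ?_
  have hn' : ((n + 1 : ℕ) : ℕ∞) < h + 1 := by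
    push_cast
    exact (ENat.add_lt_add_iff_right ENat.one_ne_top).2 hn
  have hle : monomialSpan K x h ≤ monomialSpan K x (h + 1) := monomialSpan_mono le_self_add
  obtain ⟨-, -, -, m01⟩ := monomialSpan_le_iff.1 hle n hn
  obtain ⟨m, m0, m1, m01'⟩ := monomialSpan_le_iff.1 (le_refl (monomialSpan K x (h + 1))) (n + 1) hn'
  simp only [pow_succ'] at m m0 m1 m01'
  have m1' : -(x 1 * (x 2 * x 2 ^ n)) + ℓ • (x 0 * (x 2 * x 2 ^ n)) - q • (x 0 * (x 1 * x 2 ^ n)) ∈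
      monomialSpan K x (h + 1) :=
    sub_mem (add_mem (neg_mem m1) (Submodule.smul_mem _ _ m0)) (Submodule.smul_mem _ _ m01)
  simp [hx.two_mul_zero_mul, hx.two_mul_one_mul, hx.zero_mul_zero_mul, mul_add, mul_sub, m, m0, m1',
    m01']

lemma pow_two_mul_mem (m : ℕ) (hu : u ∈ monomialSpan K x h) :
    x 2 ^ m * u ∈ monomialSpan K x (h + m) := by
  induction m with
  | zero => simpa
  | succ m ih =>
    rw [pow_succ', mul_assoc, Nat.cast_succ, ← add_assoc]
    exact hx.two_mul_mem ih

lemma mul_mem {M : ℕ} {v : A} (hu : u ∈ monomialSpan K x (M + 1 : ℕ))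
    (hv : v ∈ monomialSpan K x h) : u * v ∈ monomialSpan K x (h + M) := by
  suffices monomialSpan K x (M + 1 : ℕ) ≤
    (monomialSpan K x (h + M)).comap (LinearMap.mulRight K v) from this hu
  refine monomialSpan_le_iff.2 fun n hn => ?_
  have hnM : (n : ℕ∞) ≤ M := Nat.cast_le.2 (Nat.lt_succ_iff.1 (Nat.cast_lt.1 hn))
  have hm : x 2 ^ n * v ∈ monomialSpan K x (h + M) :=
    monomialSpan_mono (add_le_add_right hnM h) (hx.pow_two_mul_mem n hv)
  simp [mul_assoc, hm, hx.zero_mul_mem, hx.one_mul_mem]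

lemma monomialSpan_eq_top (hgen : Algebra.adjoin K (Set.range x) = ⊤) (hh : 0 < h)
    (htwo : ∀ u ∈ monomialSpan K x h, x 2 * u ∈ monomialSpan K x h) : monomialSpan K x h = ⊤ := by
  refine eq_top_of_gen_mul_mem hgen (one_mem_monomialSpan hh) fun j u hu => ?_
  fin_cases j
  exacts [hx.zero_mul_mem hu, hx.one_mul_mem hu, htwo u hu]

lemma monomialSpan_top (hgen : Algebra.adjoin K (Set.range x) = ⊤) : monomialSpan K x ⊤ = ⊤ :=
  hx.monomialSpan_eq_top hgen ENat.top_pos fun _ hu => by simpa using hx.two_mul_mem hu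

variable {b : K}

lemma monomialSpan_two (hgen : Algebra.adjoin K (Set.range x) = ⊤) (hz : deformedSquare b x = 0) :
    monomialSpan K x 2 = ⊤ := by
  have hsq : x 2 ^ 2 ∈ monomialSpan K x 2 := by
    rw [sq, eq_neg_of_add_eq_zero_left hz]
    exact neg_mem (Submodule.smul_mem _ _ (hx.zero_mul_mem
      (by simpa using hx.one_mul_mem (one_mem_monomialSpan two_pos))))
  have hle : monomialSpan K x (2 + 1) ≤ monomialSpan K x 2 := by
    refine monomialSpan_le_iff.2 fun n hn => ?_
    have hm : x 2 ^ n ∈ monomialSpan K x 2 := by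
      rcases (Nat.lt_succ_iff.1 (Nat.cast_lt.1 hn) : n ≤ 2).lt_or_eq with hn | rfl
      · exact (monomialSpan_le_iff.1 (le_refl (monomialSpan K x 2)) n (by exact_mod_cast hn)).1
      · exact hsq
    exact ⟨hm, hx.zero_mul_mem hm, hx.one_mul_mem hm, hx.zero_mul_mem (hx.one_mul_mem hm)⟩
  exact hx.monomialSpan_eq_top hgen two_pos fun u hu => hle (hx.two_mul_mem hu)

lemma deformedSquare_mul_mem (hu : u ∈ monomialSpan K x h) :
    deformedSquare b x * u ∈ monomialSpan K x (h + 2) := by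
  rw [deformedSquare_mul, ← one_add_one_eq_two, ← add_assoc]
  refine add_mem (hx.two_mul_mem (hx.two_mul_mem hu)) (Submodule.smul_mem _ _ ?_)
  rw [add_assoc]
  exact monomialSpan_mono le_self_add (hx.zero_mul_mem (hx.one_mul_mem hu))

lemma jordanChain_mem {i n : ℕ} (hi : i < 2 * n + 2) :
    jordanChain b x i ∈ monomialSpan K x (2 * n + 1 : ℕ) := by
  have hpow (m : ℕ) : deformedSquare b x ^ m ∈ monomialSpan K x (2 * m + 1 : ℕ) := by
    induction m with
    | zero => simpa using one_mem_monomialSpan one_pos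
    | succ m ih =>
      rw [pow_succ', show (2 * (m + 1) + 1 : ℕ) = (2 * m + 1) + 2 by ring, Nat.cast_add _ 2]
      exact hx.deformedSquare_mul_mem ih
  have hz : deformedSquare b x ^ (i / 2) ∈ monomialSpan K x (2 * n + 1 : ℕ) :=
    monomialSpan_mono (Nat.cast_le.2 (by omega)) (hpow (i / 2))
  rw [jordanChain]
  rcases i.mod_two_eq_zero_or_one with hi | hi <;> rw [hi]
  · rwa [pow_zero, one_mul]
  · rw [pow_one]
    exact hx.zero_mul_mem hz

lemma doubled_jordanChain_mem {n : ℕ} (j) :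
    doubled (x 2) (doubled (x 1) fun i : Fin (2 * n + 2) => jordanChain b x i) j ∈
      monomialSpan K x (2 * n + 2 : ℕ) := by
  have hone (j) : doubled (x 1) (fun i : Fin (2 * n + 2) => jordanChain b x i) j ∈
      monomialSpan K x (2 * n + 1 : ℕ) := by
    rcases j with i | i
    exacts [hx.jordanChain_mem i.2, hx.one_mul_mem (hx.jordanChain_mem i.2)]
  have hsucc : ((2 * n + 2 : ℕ) : ℕ∞) = (2 * n + 1 : ℕ) + 1 := Nat.cast_succ _
  rw [hsucc]
  rcases j with j | j
  exacts [monomialSpan_mono le_self_add (hone j), hx.two_mul_mem (hone j)]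

end QuadraticRelations

end OrderedMonomials

section Basis

variable {K : Type*} [Field K]

lemma linearIndependent_of_mem_span_of_card_le {V J J' : Type*} [AddCommGroup V] [Module K V]
    [Fintype J] [Fintype J'] {f : J → V} {g : J' → V} (hg : LinearIndependent K g)
    (hmem : ∀ j, g j ∈ Submodule.span K (Set.range f)) (hcard : Fintype.card J ≤ Fintype.card J') :
    LinearIndependent K f := by
  have hfin : FiniteDimensional K (Submodule.span K (Set.range f)) :=
    FiniteDimensional.span_of_finite K (Set.finite_range f)
  rw [linearIndependent_iff_card_le_finrank_span]
  refine hcard.trans ((linearIndependent_iff_card_le_finrank_span.1 hg).trans ?_)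
  exact Submodule.finrank_mono (Submodule.span_le.2 (Set.range_subset_iff.2 hmem))

variable {A : Type*} [Ring A] [Algebra K A] {a b k ℓ q : K} {x : Fin 3 → A}
  {d : Fin 3 → A →ₗ[K] A} {ε : A →ₐ[K] K}

lemma SkewDerivations.linearIndepOn_mkQ_monomial
    (hd : SkewDerivations (braiding15 (-1) 0 a b k ℓ q) x d ε) (hx : QuadraticRelations ℓ q x)
    {n : ℕ} (hn : ∀ m : ℕ, 0 < m → m ≤ n → (m : K) * (b * ℓ - a) ≠ 0) :
    LinearIndepOn K ((radical d ε).mkQ ∘ monomial x) (exponents (2 * n + 2 : ℕ)) := by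
  have : Fintype (exponents (2 * n + 2 : ℕ)) := (finite_exponents _).fintype
  refine linearIndependent_of_mem_span_of_card_le
    (hd.linearIndependent_mkQ_doubled_jordanChain hx hn) (fun j => ?_) ?_
  · have hj := Submodule.mem_map_of_mem (f := (radical d ε).mkQ)
      (hx.doubled_jordanChain_mem (b := b) j)
    rwa [monomialSpan, Submodule.map_span, ← Set.image_comp, Set.image_eq_range] at hj
  · rw [← Nat.card_eq_fintype_card, Nat.card_coe_set_eq, ncard_exponents]
    simp only [Fintype.card_sum, Fintype.card_fin]
    omega

lemma SkewDerivations.linearIndepOn_mkQ_monomial_top [CharZero K]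
    (hd : SkewDerivations (braiding15 (-1) 0 a b k ℓ q) x d ε) (hx : QuadraticRelations ℓ q x)
    (hab : a ≠ b * ℓ) :
    LinearIndepOn K ((radical d ε).mkQ ∘ monomial x) (exponents ⊤) := by
  have hmono : Monotone fun n : ℕ => exponents (2 * n + 2 : ℕ) := fun m n hmn =>
    exponents_mono (Nat.cast_le.2 (by omega))
  rw [← iUnion_exponents]
  exact linearIndepOn_iUnion_of_directed hmono.directed_le fun n =>
    hd.linearIndepOn_mkQ_monomial hx fun m hm _ =>
      mul_ne_zero (Nat.cast_ne_zero.2 hm.ne') (sub_ne_zero.2 hab.symm)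

lemma SkewDerivations.linearIndepOn_mkQ_monomial_two
    (hd : SkewDerivations (braiding15 (-1) 0 a b k ℓ q) x d ε) (hx : QuadraticRelations ℓ q x) :
    LinearIndepOn K ((radical d ε).mkQ ∘ monomial x) (exponents 2) :=
  hd.linearIndepOn_mkQ_monomial hx (n := 0) fun _ hm hm' => absurd hm' hm.not_ge

lemma radical_eq_bot_and_isPBWBasis {h : ℕ∞} (hspan : monomialSpan K x h = ⊤)
    (hind : LinearIndepOn K ((radical d ε).mkQ ∘ monomial x) (exponents h)) :
    radical d ε = ⊥ ∧ IsPBWBasis K x ![2, 2, h] := by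
  have hdisj := Submodule.range_ker_disjoint hind
  rw [← Set.image_eq_range, ← monomialSpan, hspan, Submodule.ker_mkQ, top_disjoint] at hdisj
  exact ⟨hdisj, isPBWBasis_iff.2 ⟨hind.of_comp _, hspan⟩⟩

end Basis

section Growth

open Filter Topology

lemma tendsto_log_mul_pow_div_log {C : ℝ} (hC : 0 < C) (d : ℕ) :
    Tendsto (fun n : ℕ => Real.log (C * (n + 1) ^ d) / Real.log n) atTop (𝓝 d) := by
  have hlog : Tendsto (fun n : ℕ => Real.log n) atTop atTop :=
    Real.tendsto_log_atTop.comp tendsto_natCast_atTop_atTop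
  have hC' : Tendsto (fun n : ℕ => Real.log C / Real.log n) atTop (𝓝 0) := hlog.const_div_atTop _
  have hsucc : Tendsto (fun n : ℕ => (Real.log (n + 1) - Real.log n) / Real.log n) atTop (𝓝 0) :=
    Real.tendsto_log_nat_add_one_sub_log.div_atTop hlog
  have hsum := hC'.add ((hsucc.add_const 1).const_mul (d : ℝ))
  rw [zero_add, zero_add, mul_one] at hsum
  refine hsum.congr' ?_
  filter_upwards [hlog.eventually_gt_atTop 0] with n hn
  rw [Real.log_mul hC.ne' (by positivity), Real.log_pow]
  field_simp
  ring

lemma tendsto_ereal_log_mul_pow_div_log {C : ℝ} (hC : 0 < C) (d : ℕ) :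
    Tendsto (fun n : ℕ => ((Real.log (C * (n + 1) ^ d) / Real.log n : ℝ) : EReal)) atTop (𝓝 d) :=
  (continuous_coe_real_ereal.tendsto (d : ℝ)).comp (tendsto_log_mul_pow_div_log hC d)

lemma log_natCast_le_log_natCast {m n : ℕ} (h : m ≤ n) : Real.log m ≤ Real.log n := by
  rcases m.eq_zero_or_pos with rfl | hm
  · simpa using Real.log_natCast_nonneg n
  · exact Real.log_le_log (Nat.cast_pos.2 hm) (Nat.cast_le.2 h)

variable {K : Type*} [Field K] {A : Type*} [Ring A] [Algebra K A]

lemma one_le_gkDim {y : A} (hy : LinearIndependent K fun n : ℕ => y ^ n) : 1 ≤ gkDim K A := by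
  refine le_iSup₂_of_le (Submodule.span K {y}) (Submodule.fg_span_singleton y) ?_
  have hfinrank (n : ℕ) : Module.finrank K
      (⨆ i ∈ Finset.range (n + 1), Submodule.span K {y} ^ i : Submodule K A) = n + 1 := by
    have hspan : (⨆ i ∈ Finset.range (n + 1), Submodule.span K {y} ^ i : Submodule K A) =
        Submodule.span K (Set.range fun i : Fin (n + 1) => y ^ (i : ℕ)) := by
      simp only [Submodule.span_pow, Set.singleton_pow, ← Submodule.span_iUnion₂]
      congr 1
      ext u
      simp [Fin.exists_iff, eq_comm]
    rw [hspan]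
    exact (finrank_span_eq_card (hy.comp _ Fin.val_injective)).trans (Fintype.card_fin _)
  have hlim := tendsto_ereal_log_mul_pow_div_log one_pos 1
  simp only [one_mul, pow_one, Nat.cast_one] at hlim
  simp only [hfinrank, Nat.cast_add, Nat.cast_one, hlim.limsup_eq, le_refl]

/-- The dimension of the powers of a finite-dimensional subspace is controlled by any exhaustive
filtration, since the subspace lies in one of its pieces. -/
lemma gkDim_le_of_filtration {F : ℕ → Submodule K A} (hmono : Monotone F)
    (hexh : ∀ u, ∃ n, u ∈ F n) (hone : 1 ∈ F 0) (hmul : ∀ m n, F m * F n ≤ F (m + n))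
    [∀ n, FiniteDimensional K (F n)] {C d : ℕ}
    (hdim : ∀ n, Module.finrank K (F n) ≤ C * (n + 1) ^ d) : gkDim K A ≤ d := by
  refine iSup₂_le fun W hW => ?_
  obtain ⟨m, hm⟩ : ∃ m, W ≤ F m := by
    obtain ⟨s, rfl⟩ := hW
    choose m hm using hexh
    exact ⟨s.sup m, Submodule.span_le.2 fun u hu => hmono (Finset.le_sup hu) (hm u)⟩
  have hpow (i : ℕ) : W ^ i ≤ F (m * i) := by
    induction i with
    | zero => simpa [Submodule.one_le] using hone
    | succ i ih => exact pow_succ W i ▸ (mul_le_mul' ih hm).trans (hmul _ _)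
  have hfinrank (n : ℕ) : Module.finrank K (⨆ i ∈ Finset.range (n + 1), W ^ i : Submodule K A) ≤
      (C * (m + 1) ^ d + 1) * (n + 1) ^ d := by
    have hle : (⨆ i ∈ Finset.range (n + 1), W ^ i : Submodule K A) ≤ F (m * n) :=
      iSup₂_le fun i hi => (hpow i).trans
        (hmono (Nat.mul_le_mul_left m (Nat.lt_succ_iff.1 (Finset.mem_range.1 hi))))
    calc _ ≤ C * (m * n + 1) ^ d := (Submodule.finrank_mono hle).trans (hdim _)
      _ ≤ C * ((m + 1) * (n + 1)) ^ d := by gcongr; nlinarith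
      _ ≤ _ := by rw [mul_pow, ← mul_assoc]; gcongr; exact Nat.le_succ _
  have hlim := tendsto_ereal_log_mul_pow_div_log
    (C := (C * (m + 1) ^ d + 1 : ℕ)) (by positivity) d
  rw [← hlim.limsup_eq]
  refine limsup_le_limsup (.of_forall fun n => EReal.coe_le_coe_iff.2 ?_)
  refine div_le_div_of_nonneg_right ?_ (Real.log_natCast_nonneg n)
  exact_mod_cast log_natCast_le_log_natCast (hfinrank n)

end Growth

section PBWBasis

variable {K : Type*} [Field K] {A : Type*} [Ring A] [Algebra K A] {x : Fin 3 → A}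

instance (N : ℕ) : FiniteDimensional K (monomialSpan K x N) :=
  FiniteDimensional.span_of_finite K ((finite_exponents N).image _)

lemma finrank_monomialSpan_le (N : ℕ) : Module.finrank K (monomialSpan K x N) ≤ 4 * N := by
  have hfin := (finite_exponents N).image (monomial x)
  have := hfin.fintype
  calc Module.finrank K (monomialSpan K x N) ≤ (monomial x '' exponents N).toFinset.card :=
        finrank_span_le_card _
    _ ≤ (exponents N).ncard := by
        rw [← Set.ncard_eq_toFinset_card']
        exact Set.ncard_image_le (finite_exponents N)
    _ = 4 * N := ncard_exponents N

lemma exists_mem_monomialSpan {u : A} (hu : u ∈ monomialSpan K x ⊤) :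
    ∃ n : ℕ, u ∈ monomialSpan K x (2 * n + 2 : ℕ) := by
  rw [monomialSpan, ← iUnion_exponents, Set.image_iUnion, Submodule.span_iUnion] at hu
  refine (Submodule.mem_iSup_of_directed _ (Monotone.directed_le fun m n hmn => ?_)).1 hu
  exact monomialSpan_mono (Nat.cast_le.2 (by omega))

lemma finrank_eq_eight_of_isPBWBasis (hx : IsPBWBasis K x ![2, 2, 2]) : Module.finrank K A = 8 := by
  have hcard : Nat.card (exponents 2) = 8 := ncard_exponents 2
  rw [← hcard]
  exact Module.finrank_eq_nat_card_basis (Module.Basis.mk hx.1 hx.2.ge)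

lemma IsPBWBasis.linearIndependent_pow (hx : IsPBWBasis K x ![2, 2, ⊤]) :
    LinearIndependent K fun n : ℕ => x 2 ^ n := by
  let e (n : ℕ) : exponents ⊤ := ⟨![0, 0, n], mem_exponents.2 (by simp)⟩
  have he : Function.Injective e := fun m n hmn => by simpa [e] using hmn
  have hpow : (fun n : ℕ => x 2 ^ n) = (fun e : exponents ⊤ => monomial x e) ∘ e :=
    funext fun n => by simp [e, monomial]
  exact hpow ▸ hx.1.comp e he

lemma QuadraticRelations.gkDim_eq_one {ℓ q : K} (hrel : QuadraticRelations ℓ q x)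
    (hx : IsPBWBasis K x ![2, 2, ⊤]) : gkDim K A = 1 := by
  refine le_antisymm ?_ (one_le_gkDim hx.linearIndependent_pow)
  have htop : monomialSpan K x ⊤ = ⊤ := (isPBWBasis_iff.1 hx).2
  suffices gkDim K A ≤ (1 : ℕ) by exact_mod_cast this
  refine gkDim_le_of_filtration (F := fun n => monomialSpan K x (n + 1 : ℕ)) (C := 4)
    (fun m n hmn => monomialSpan_mono (Nat.cast_le.2 (Nat.succ_le_succ hmn))) (fun u => ?_)
    (one_mem_monomialSpan (by simp)) (fun m n => Submodule.mul_le.2 fun u hu v hv => ?_)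
    fun n => by simpa using finrank_monomialSpan_le (K := K) (x := x) (n + 1)
  · obtain ⟨n, hn⟩ := exists_mem_monomialSpan (htop.ge (Submodule.mem_top (x := u)))
    exact ⟨2 * n + 1, hn⟩
  · have huv := hrel.mul_mem hu hv
    rwa [← Nat.cast_add, show n + 1 + m = m + n + 1 by ring] at huv

end PBWBasis

section DefiningRelations

variable {K : Type*} [Field K] {B : Type*} [Ring B] [Algebra K B]

lemma lift_eq_zero_of_mem_span {ι : Type*} {s : Set (FreeAlgebra K ι)} {y : ι → B}
    (hs : ∀ u ∈ s, FreeAlgebra.lift K y u = 0) {u : FreeAlgebra K ι}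
    (hu : u ∈ TwoSidedIdeal.span s) : FreeAlgebra.lift K y u = 0 := by
  have hle : TwoSidedIdeal.span s ≤ TwoSidedIdeal.ker (FreeAlgebra.lift K y) :=
    TwoSidedIdeal.span_le.2 fun v hv => (TwoSidedIdeal.mem_ker _).2 (hs v hv)
  exact (TwoSidedIdeal.mem_ker _).1 (hle hu)

variable (ℓ q : K)

/-- The relations `QuadraticRelations ℓ q` as elements of the free algebra. -/
def quadraticRelators : Set (FreeAlgebra K (Fin 3)) :=
  {x₂ K * x₁ K + x₁ K * x₂ K,
    x₃ K * x₁ K + x₁ K * x₃ K,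
    x₃ K * x₂ K + x₂ K * x₃ K - ℓ • (x₁ K * x₃ K) + q • (x₁ K * x₂ K),
    x₁ K ^ 2,
    x₂ K ^ 2 - ℓ • (x₁ K * x₂ K)}

variable {ℓ q}

lemma quadraticRelations_iff {y : Fin 3 → B} : QuadraticRelations ℓ q y ↔
    ∀ u ∈ quadraticRelators ℓ q, FreeAlgebra.lift K y u = 0 := by
  have htwo_one : y 2 * y 1 + y 1 * y 2 - ℓ • (y 0 * y 2) + q • (y 0 * y 1) = 0 ↔
      y 2 * y 1 = -(y 1 * y 2) + ℓ • (y 0 * y 2) - q • (y 0 * y 1) := by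
    rw [← sub_eq_zero (a := y 2 * y 1)]
    abel_nf
  simp only [quadraticRelators, Set.forall_mem_insert, Set.mem_singleton_iff, forall_eq, map_add,
    map_sub, map_smul, map_mul, FreeAlgebra.lift_ι_apply, htwo_one, sq, sub_eq_zero,
    add_eq_zero_iff_eq_neg]
  exact ⟨fun h => ⟨h.2, h.4, h.5, h.1, h.3⟩, fun ⟨h₁, h₂, h₃, h₄, h₅⟩ => ⟨h₄, h₁, h₅, h₂, h₃⟩⟩

lemma lift_deformedSquare (b : K) (y : Fin 3 → B) :
    FreeAlgebra.lift K y (deformedSquare b (FreeAlgebra.ι K)) = deformedSquare b y := by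
  simp only [deformedSquare, map_add, map_smul, map_mul, FreeAlgebra.lift_ι_apply]

lemma quadraticRelators_union_deformedSquare (b : K) :
    quadraticRelators ℓ q ∪ {deformedSquare b (FreeAlgebra.ι K)} =
      {x₂ K * x₁ K + x₁ K * x₂ K,
        x₃ K * x₁ K + x₁ K * x₃ K,
        x₃ K * x₂ K + x₂ K * x₃ K - ℓ • (x₁ K * x₃ K) + q • (x₁ K * x₂ K),
        x₁ K ^ 2,
        x₂ K ^ 2 - ℓ • (x₁ K * x₂ K),
        x₃ K ^ 2 + b • (x₁ K * x₂ K)} := by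
  simp only [quadraticRelators, deformedSquare, Set.insert_union, Set.singleton_union, sq]

lemma QuadraticRelations.lift_eq_zero {b : K} {y : Fin 3 → B} (hy : QuadraticRelations ℓ q y)
    (hz : deformedSquare b y = 0) {u : FreeAlgebra K (Fin 3)}
    (hu : u ∈ TwoSidedIdeal.span
      (quadraticRelators ℓ q ∪ {deformedSquare b (FreeAlgebra.ι K)})) :
    FreeAlgebra.lift K y u = 0 := by
  refine lift_eq_zero_of_mem_span ?_ hu
  rintro u (hu | rfl)
  exacts [quadraticRelations_iff.1 hy u hu, by rw [lift_deformedSquare, hz]]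

end DefiningRelations

section NicholsAlgebra

variable {K : Type*} [Field K]

lemma defRel_eq_and_isPBWBasis_gen {r : Matrix (Fin 3 × Fin 3) (Fin 3 × Fin 3) K}
    {I : TwoSidedIdeal (FreeAlgebra K (Fin 3))}
    {d : Fin 3 → FreeAlgebra K (Fin 3) ⧸ I.asIdeal →ₗ[K] FreeAlgebra K (Fin 3) ⧸ I.asIdeal}
    {ε : FreeAlgebra K (Fin 3) ⧸ I.asIdeal →ₐ[K] K} {h : ℕ∞}
    (hd : SkewDerivations r (quotientGen I) d ε) (hspan : monomialSpan K (quotientGen I) h = ⊤)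
    (hind : LinearIndepOn K ((radical d ε).mkQ ∘ monomial (quotientGen I)) (exponents h)) :
    (defRel r : Set (FreeAlgebra K (Fin 3))) = I ∧
      IsPBWBasis K (NicholsAlgebra.gen r) ![2, 2, h] := by
  obtain ⟨hrad, hbasis⟩ := radical_eq_bot_and_isPBWBasis hspan hind
  have hdef := defRel_eq_of_radical_eq_bot hd hrad
  have hI : TwoSidedIdeal.span (defRel r : Set (FreeAlgebra K (Fin 3))) = I := by
    rw [hdef, span_coe_eq]
  refine ⟨hdef, ?_⟩
  have htransfer (J : TwoSidedIdeal (FreeAlgebra K (Fin 3))) (hJ : J = I) :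
      IsPBWBasis K (quotientGen J) ![2, 2, h] := hJ ▸ hbasis
  exact htransfer _ hI

variable {a b k ℓ q : K} {I : TwoSidedIdeal (FreeAlgebra K (Fin 3))}

lemma quadraticRelations_quotientGen (hI : quadraticRelators ℓ q ⊆ I) :
    QuadraticRelations ℓ q (quotientGen I) :=
  quadraticRelations_iff.2 fun u hu => (lift_quotientGen_eq_zero_iff I u).2 (hI hu)

lemma exists_skewDerivations_quadraticRelators (a b k ℓ q : K) :
    ∃ d ε, SkewDerivations (braiding15 (-1) 0 a b k ℓ q)
      (quotientGen (TwoSidedIdeal.span (quadraticRelators ℓ q))) d ε := by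
  refine exists_skewDerivations_quotientGen _ _
    (fun u hu => lift_eq_zero_of_mem_span (quadraticRelations_iff.1 ?_) hu)
    (fun u hu => lift_eq_zero_of_mem_span (quadraticRelations_iff.1 ?_) hu)
  · exact quadraticRelations_skewOp a b k
      (quadraticRelations_quotientGen TwoSidedIdeal.subset_span)
  · constructor <;> simp

lemma deformedSquare_quotientGen (hI : deformedSquare b (FreeAlgebra.ι K) ∈ I) :
    deformedSquare b (quotientGen I) = 0 := by
  rw [← lift_deformedSquare, lift_quotientGen_eq_zero_iff]
  exact hI

lemma deformedSquare_skewOp_eq_zero {A : Type*} [Ring A] [Algebra K A]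
    {x : Fin 3 → A} (h : QuadraticRelations ℓ q x) (hz : deformedSquare b x = 0)
    (hab : a = b * ℓ) :
    deformedSquare b (skewOp (braiding15 (-1) 0 a b k ℓ q) x) = 0 :=
  linearMap_jet_ext fun y y₀ y₁ y₂ => by
    rw [deformedSquare_skewOp a b k y y₀ y₁ y₂ h]
    simp [hz, hab]

lemma exists_skewDerivations_quadraticRelators_union (k q : K) (hab : a = b * ℓ) :
    ∃ d ε, SkewDerivations (braiding15 (-1) 0 a b k ℓ q)
      (quotientGen (TwoSidedIdeal.span
        (quadraticRelators ℓ q ∪ {deformedSquare b (FreeAlgebra.ι K)}))) d ε := by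
  have hsub := TwoSidedIdeal.subset_span
    (s := quadraticRelators ℓ q ∪ {deformedSquare b (FreeAlgebra.ι K)})
  have hx := quadraticRelations_quotientGen (Set.subset_union_left.trans hsub)
  have hz := deformedSquare_quotientGen (hsub (Or.inr rfl))
  refine exists_skewDerivations_quotientGen _ _
    (fun u hu => (quadraticRelations_skewOp a b k hx).lift_eq_zero ?_ hu)
    (fun u hu => QuadraticRelations.lift_eq_zero (ℓ := ℓ) (q := q) (b := b) ?_ ?_ hu)
  · exact deformedSquare_skewOp_eq_zero hx hz hab
  · constructor <;> simp
  · simp [deformedSquare]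

end NicholsAlgebra

end

end NicholsRankThree

theorem proposition3p11_general {K : Type*} [Field K] (a b k ℓ q : K) :
    (CharZero K → a ≠ b * ℓ →
      (defRel (braiding15 (-1) 0 a b k ℓ q) : Set (FreeAlgebra K (Fin 3))) =
        (TwoSidedIdeal.span
          {x₂ K * x₁ K + x₁ K * x₂ K,
            x₃ K * x₁ K + x₁ K * x₃ K,
            x₃ K * x₂ K + x₂ K * x₃ K - ℓ • (x₁ K * x₃ K) + q • (x₁ K * x₂ K),
            x₁ K ^ 2,
            x₂ K ^ 2 - ℓ • (x₁ K * x₂ K)} : Set (FreeAlgebra K (Fin 3))) ∧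
      IsPBWBasis K (NicholsAlgebra.gen (braiding15 (-1) 0 a b k ℓ q)) ![2, 2, ⊤] ∧
      gkDim K (NicholsAlgebra (braiding15 (-1) 0 a b k ℓ q)) = 1) ∧
    (a = b * ℓ →
      (defRel (braiding15 (-1) 0 a b k ℓ q) : Set (FreeAlgebra K (Fin 3))) =
        (TwoSidedIdeal.span
          {x₂ K * x₁ K + x₁ K * x₂ K,
            x₃ K * x₁ K + x₁ K * x₃ K,
            x₃ K * x₂ K + x₂ K * x₃ K - ℓ • (x₁ K * x₃ K) + q • (x₁ K * x₂ K),
            x₁ K ^ 2,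
            x₂ K ^ 2 - ℓ • (x₁ K * x₂ K),
            x₃ K ^ 2 + b • (x₁ K * x₂ K)} : Set (FreeAlgebra K (Fin 3))) ∧
      IsPBWBasis K (NicholsAlgebra.gen (braiding15 (-1) 0 a b k ℓ q)) ![2, 2, 2] ∧
      Module.finrank K (NicholsAlgebra (braiding15 (-1) 0 a b k ℓ q)) = 8) := by
  refine ⟨fun _ hab => ?_, fun hab => ?_⟩
  · obtain ⟨d, ε, hd⟩ := exists_skewDerivations_quadraticRelators a b k ℓ q
    have hrel := quadraticRelations_quotientGen (K := K) (ℓ := ℓ) (q := q)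
      TwoSidedIdeal.subset_span
    obtain ⟨hdef, hbasis⟩ := defRel_eq_and_isPBWBasis_gen hd
      (hrel.monomialSpan_top (adjoin_quotientGen _)) (hd.linearIndepOn_mkQ_monomial_top hrel hab)
    have hgen : QuadraticRelations ℓ q (NicholsAlgebra.gen (braiding15 (-1) 0 a b k ℓ q)) :=
      quadraticRelations_quotientGen
        (hdef ▸ TwoSidedIdeal.subset_span.trans TwoSidedIdeal.subset_span)
    exact ⟨hdef, hbasis, hgen.gkDim_eq_one hbasis⟩
  · rw [← quadraticRelators_union_deformedSquare]
    obtain ⟨d, ε, hd⟩ := exists_skewDerivations_quadraticRelators_union k q hab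
    have hsub := TwoSidedIdeal.subset_span
      (s := quadraticRelators ℓ q ∪ {deformedSquare b (FreeAlgebra.ι K)})
    have hrel := quadraticRelations_quotientGen (Set.subset_union_left.trans hsub)
    have hzero := deformedSquare_quotientGen (hsub (Or.inr rfl))
    obtain ⟨hdef, hbasis⟩ := defRel_eq_and_isPBWBasis_gen hd
      (hrel.monomialSpan_two (adjoin_quotientGen _) hzero) (hd.linearIndepOn_mkQ_monomial_two hrel)
    exact ⟨hdef, hbasis, finrank_eq_eight_of_isPBWBasis hbasis⟩

theorem proposition3p11 {K : Type*} [Field K] [IsAlgClosed K] [CharZero K]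
    (t p a b k ℓ q : K) (ht : t = -1) (hp : p = 0) :
    (a ≠ b * ℓ →
      (defRel (braiding15 t p a b k ℓ q) : Set (FreeAlgebra K (Fin 3))) =
        (TwoSidedIdeal.span
          {x₂ K * x₁ K + x₁ K * x₂ K,
            x₃ K * x₁ K + x₁ K * x₃ K,
            x₃ K * x₂ K + x₂ K * x₃ K - ℓ • (x₁ K * x₃ K) + q • (x₁ K * x₂ K),
            x₁ K ^ 2,
            x₂ K ^ 2 - ℓ • (x₁ K * x₂ K)} : Set (FreeAlgebra K (Fin 3))) ∧
      IsPBWBasis K (NicholsAlgebra.gen (braiding15 t p a b k ℓ q)) ![2, 2, ⊤] ∧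
      gkDim K (NicholsAlgebra (braiding15 t p a b k ℓ q)) = 1) ∧
    (a = b * ℓ →
      (defRel (braiding15 t p a b k ℓ q) : Set (FreeAlgebra K (Fin 3))) =
        (TwoSidedIdeal.span
          {x₂ K * x₁ K + x₁ K * x₂ K,
            x₃ K * x₁ K + x₁ K * x₃ K,
            x₃ K * x₂ K + x₂ K * x₃ K - ℓ • (x₁ K * x₃ K) + q • (x₁ K * x₂ K),
            x₁ K ^ 2,
            x₂ K ^ 2 - ℓ • (x₁ K * x₂ K),
            x₃ K ^ 2 + b • (x₁ K * x₂ K)} : Set (FreeAlgebra K (Fin 3))) ∧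
      IsPBWBasis K (NicholsAlgebra.gen (braiding15 t p a b k ℓ q)) ![2, 2, 2] ∧
      Module.finrank K (NicholsAlgebra (braiding15 t p a b k ℓ q)) = 8) := by
  subst ht hp
  exact ⟨(proposition3p11_general a b k ℓ q).1 inferInstance,
    (proposition3p11_general a b k ℓ q).2⟩
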